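/- Let $G_p=(V,E)$ be a locally finite connected simple graph (each edge being used in both directions) with transition probabilities $\mathbf p=\{p(x,y)\}_{x,y\in V}$, that is, $0<p(x,y)\le 1$ if $x,y$ are adjacent, $p(x,y)=0$ otherwise, and $\sum_{y}p(x,y)=1$ for every $x\in V$. Its probabilistic graph Laplacian is $\Delta_{\mathbf p}f(x)=f(x)-\sum_{y}p(x,y)f(y)$. Let $n_0\ge 1$ and let $\mathcal J_{cs}=(\mathcal J_{cs}(i,j))_{0\le i,j\le n_0}$ be a complex tridiagonal matrix that is centrosymmetric, $\mathcal J_{cs}(n_0-i,n_0-j)=\mathcal J_{cs}(i,j)$, and whose entries $a(k)=\mathcal J_{cs}(k-1,k)$, $1\le k\le n_0$, are all nonzero. Put $$R_{\mathcal J_{cs}}(z)=1-\frac{P_{n_0}(z)}{\prod_{i=1}^{n_0}a(i)},$$ where $P_{n_0}(z)$ is the determinant of the leading principal $n_0\times n_0$ submatrix of $zI-\mathcal J_{cs}$. Let $G$ be the graph obtained by replacing each edge $\{u,v\}$ of $G_p$ with its own copy of the path with vertices $0,\dots,n_0$, where $u$ is identified with $0$ and $v$ with $n_0$ (or conversely,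 which makes no difference), and let $\mathcal J$ be the following matrix indexed by the vertices of $G$. If $x$ is a vertex of a copy, at position $\varphi(x)$ in it, then $\mathcal J(x,x)=\mathcal J_{cs}(\varphi(x),\varphi(x))$. If $x,y$ are adjacent vertices of the copy replacing $\{u,v\}$, then $\mathcal J(x,y)=p(u,v)\,\mathcal J_{cs}(0,1)$ if $x=u$, and $\mathcal J(x,y)=\mathcal J_{cs}(\varphi(x),\varphi(y))$ if $x\notin V$. All other entries are zero. Assume that there are strictly positive weights $\pi_p$ on $V$ and $\pi_J$ on $V(G)$ such that $\Delta_{\mathbf p}$ is a bounded self-adjoint operator on $\ell^2(V,\pi_p)$ and $\mathcal J$ is a bounded self-adjoint operator on $\ell^2(V(G),\pi_J)$, and let $\sigma(\Delta_{\mathbf p})$ and $\sigma(\mathcal J)$ be their spectra. If $0$ and $2$ are limit points (accumulation points) of $\sigma(\Delta_{\mathbf p})$, then $$\sigma(\mathcal J)=R_{\mathcal J_{cs}}^{-1}\big(\sigma(\Delta_{\mathbf p})\big)=\{z\in\mathbb C : R_{\mathcal J_{cs}}(z)\in\sigma(\Delta_{\mathbf p})\}.$$ -/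

import Mathlib

noncomputable section

open Topology Filter MeasureTheory

namespace PiecewiseCentrosymmetric

/-! ### Weighted square summable functions and operators on them -/

/-- The measure on the discrete space `X` in which the point `x` has mass `w x`. -/
def weightMeasure {X : Type*} (w : X → ℝ) : @Measure X ⊤ :=
  @Measure.sum X X ⊤ fun x => ENNReal.ofReal (w x) • @Measure.dirac X ⊤ x

/-- The Hilbert space of functions `f : X → ℂ` with `∑ |f x|² w x < ∞`. It is used for positive
weights only, in which case two functions that agree almost everywhere are equal. -/
abbrev WeightedEll2 {X : Type*} (w : X → ℝ) : Type _ :=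
  Lp ℂ 2 (weightMeasure w)

/-- The bounded operator `T` is given by the map `L` on functions. -/
def ActsAs {X : Type*} {w : X → ℝ} (T : WeightedEll2 w →L[ℂ] WeightedEll2 w)
    (L : (X → ℂ) → X → ℂ) : Prop :=
  ∀ (f : WeightedEll2 w) (x : X), (T f : X → ℂ) x = L (f : X → ℂ) x

/-- The action of a matrix with finitely many nonzero entries in each row on functions. -/
def matrixAction {X : Type*} (A : X → X → ℂ) (f : X → ℂ) (x : X) : ℂ :=
  ∑ᶠ y, A x y * f y

/-! ### The model graph and its probabilistic Laplacian

All edges of the model graph come in both directions, so that it is recorded as an undirected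
graph. -/

/-- `p` is a family of transition probabilities on the graph `G`. -/
structure IsTransitionProbability {V : Type*} (G : SimpleGraph V) [G.LocallyFinite]
    (p : V → V → ℝ) : Prop where
  adj_iff : ∀ x y, G.Adj x y ↔ 0 < p x y ∧ p x y ≤ 1
  not_adj_iff : ∀ x y, ¬ G.Adj x y ↔ p x y = 0
  sum_eq_one : ∀ x, ∑ y ∈ G.neighborFinset x, p x y = 1

/-- The probabilistic graph Laplacian. -/
def probLaplacian {V : Type*} (G : SimpleGraph V) [G.LocallyFinite] (p : V → V → ℝ)
    (f : V → ℂ) (x : V) : ℂ :=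
  f x - ∑ y ∈ G.neighborFinset x, (p x y : ℂ) * f y

/-! ### Centrosymmetric Jacobi matrices -/

/-- Tridiagonal matrices `A` of size `n + 1` with `A = R A R`, where `R` is the anti-diagonal
identity matrix. With `a k = A (k - 1) k` for `1 ≤ k ≤ n` and `b k = A k k`, this says that `b` is
symmetric under `k ↦ n - k` and that `A k (k - 1) = a (n + 1 - k)`. -/
structure IsCentrosymmetricJacobi {n : ℕ} (A : Matrix (Fin (n + 1)) (Fin (n + 1)) ℂ) : Prop where
  tridiagonal : ∀ i j : Fin (n + 1), (i : ℕ) + 1 < j ∨ (j : ℕ) + 1 < i → A i j = 0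
  centrosymmetric : A.submatrix Fin.rev Fin.rev = A

/-- The product `a 1 * ⋯ * a n` of the entries above the diagonal. -/
def upperProd {n : ℕ} (A : Matrix (Fin (n + 1)) (Fin (n + 1)) ℂ) : ℂ :=
  ∏ i : Fin n, A i.castSucc i.succ

/-- The determinant of the leading principal `n × n` submatrix of `z I - A`, where `A` has size
`n + 1`. -/
def leadingPoly {n : ℕ} (A : Matrix (Fin (n + 1)) (Fin (n + 1)) ℂ) (z : ℂ) : ℂ :=
  (z • (1 : Matrix (Fin n) (Fin n) ℂ) - A.submatrix Fin.castSucc Fin.castSucc).det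

/-- The spectral decimation function of `A`. -/
def decimationFunction {n : ℕ} (A : Matrix (Fin (n + 1)) (Fin (n + 1)) ℂ) (z : ℂ) : ℂ :=
  1 - leadingPoly A z / upperProd A

/-! ### Substitution -/

/-- The interior vertices `1, …, n - 1` of the path graph with vertices `0, …, n`. -/
abbrev Interior (n : ℕ) : Type := {k : Fin (n + 1) // k ≠ 0 ∧ k ≠ Fin.last n}

/-- The vertices of the substitution graph: the vertices of `G` and, for every undirected edge of
`G`, the interior vertices of a copy of the path graph. -/
abbrev SubstVertex {V : Type*} (G : SimpleGraph V) (n : ℕ) : Type _ :=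
  V ⊕ (G.edgeSet × Interior n)

/-- The endpoint of the edge `e` that is identified with the vertex `0` of the copy of the path
graph which replaces `e`. Which of the two endpoints this is makes no difference, because the
matrix on the path graph is centrosymmetric. -/
def source {V : Type*} {G : SimpleGraph V} (e : G.edgeSet) : V := (Quot.out e.1).1

/-- The endpoint of the edge `e` that is identified with the vertex `n` of the copy of the path
graph which replaces `e`. -/
def target {V : Type*} {G : SimpleGraph V} (e : G.edgeSet) : V := (Quot.out e.1).2

open Classical in
/-- The piecewise centrosymmetric Jacobi matrix obtained from the transition probabilities `p` on
`G` and the centrosymmetric Jacobi matrix `A`. Diagonal entries are those of `A`. Within the copy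
of the path graph that replaces the edge `{u, v}`, an entry in the row of an interior vertex is the
corresponding entry of `A`, and an entry in the row of `u` is the corresponding entry of `A`
multiplied by `p u v`. By tridiagonality and centrosymmetry, the latter entry is `p u v * A 0 1` at
the neighbour of `u` in the copy and `0` at its other vertices. Entries at two different vertices
that do not lie in a common copy vanish. -/
def substJacobi {V : Type*} (G : SimpleGraph V) (p : V → V → ℝ) {n : ℕ}
    (A : Matrix (Fin (n + 1)) (Fin (n + 1)) ℂ) : SubstVertex G n → SubstVertex G n → ℂ
  | Sum.inl u, Sum.inl v => if u = v then A 0 0 else p u v * A 0 (Fin.last n)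
  | Sum.inl u, Sum.inr (e, j) =>
      if u = source e then p u (target e) * A 0 j
      else if u = target e then p u (source e) * A (Fin.last n) j
      else 0
  | Sum.inr (e, i), Sum.inl v =>
      if v = source e then A i 0
      else if v = target e then A i (Fin.last n)
      else 0
  | Sum.inr (e, i), Sum.inr (e', j) => if e = e' then A i j else 0

end PiecewiseCentrosymmetric

end

/-!
The interior of each inserted path is eliminated from the equation `(z - J) g = h`. Let
`R = decimationFunction A` and let `θ` be the function on the path with `θ 0 = 1` for which
`(z - A) θ` is supported at `n`. Cramer's rule gives `θ n = 1 - R z`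
(`exists_pencil_castSucc_eq_zero`). Since `A` is centrosymmetric, the reflection of `θ` also solves
the interior equations, and when `R z ≠ 0, 2`, that is `(θ n)² ≠ 1`, these two functions span the
interior solutions and can be combined to any boundary values, while the interior problem with zero
boundary values is uniquely solvable (`exists_dirichlet_solution`). The boundary rows of `z - A` at
the solution `φ` with boundary values `1` and `0` are `(R z - 1) b` and `b` with `b ≠ 0`, so that
for a function `g` on the substitution graph which solves the interior equations, `(z - J) g` is
`b (R z - Δ) f` at the vertices of `G`, where `f` is the restriction of `g`.

The spectrum of a self-adjoint operator consists of the `z` at which it is not bounded below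
(`notMem_spectrum_iff_isBoundedBelow`), so for `R z ≠ 0, 2` it is enough to compare lower bounds for
`z - J` and `R z - Δ` (`isBoundedBelow_subst_iff`). This works because self-adjointness fixes the
weights: `Δ` and `J` satisfy detailed balance with respect to the same transition probabilities, so
the weight of `J` on the vertices of `G` is a multiple of the weight of `Δ`, and in the interior of
an edge it is the conductance of the edge times a factor depending only on the position
(`exists_weight_interior`). Square norms are computed as sums in `ℝ≥0∞`.

If `R z` is `0` or `2`, then it is an accumulation point of the spectrum of `Δ` and so belongs to
it. As `R` is open, there are points `x` arbitrarily close to `z` with `R x ≠ 0, 2` in the spectrum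
of `Δ`; these `x` belong to the spectrum of `J`, which is closed.
-/

noncomputable section

open Topology Filter MeasureTheory Matrix
open scoped ENNReal NNReal

namespace PiecewiseCentrosymmetric

/-! ### Weighted square summable functions -/

/-- A normal operator which is bounded below is invertible: the orthogonal complement of its range
is its kernel. -/
theorem isUnit_iff_antilipschitz_of_isStarNormal {H : Type*} [NormedAddCommGroup H]
    [InnerProductSpace ℂ H] [CompleteSpace H] (T : H →L[ℂ] H) (hT : IsStarNormal T) :
    IsUnit T ↔ ∃ c, AntilipschitzWith c T := by
  rw [ContinuousLinearMap.isUnit_iff_bijective,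
    ContinuousLinearMap.bijective_iff_dense_range_and_antilipschitz]
  refine ⟨fun h => h.2, fun h => ⟨?_, h⟩⟩
  obtain ⟨c, hc⟩ := h
  have hker : T.ker = ⊥ := LinearMap.ker_eq_bot.mpr hc.injective
  rw [Submodule.topologicalClosure_eq_top_iff, ContinuousLinearMap.IsStarNormal.orthogonal_range hT]
  exact hker

section WeightMeasure

variable {X : Type*} {w : X → ℝ}

theorem lintegral_weightMeasure (w : X → ℝ) (F : X → ℝ≥0∞) :
    ∫⁻ x, F x ∂(weightMeasure w) = ∑' x, ENNReal.ofReal (w x) * F x := by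
  let : MeasurableSpace X := ⊤
  rw [weightMeasure, lintegral_sum_measure]
  refine tsum_congr fun x => ?_
  rw [lintegral_smul_measure, lintegral_dirac' _ (measurable_from_top), smul_eq_mul]

theorem weightMeasure_singleton (w : X → ℝ) (x : X) :
    weightMeasure w {x} = ENNReal.ofReal (w x) := by
  let : MeasurableSpace X := ⊤
  classical
  rw [← lintegral_indicator_one (μ := weightMeasure w) (MeasurableSpace.measurableSet_top),
    lintegral_weightMeasure, tsum_eq_single x]
  · simp
  · intro y hy
    simp [hy]

theorem ae_weightMeasure_iff (hw : ∀ x, 0 < w x) {P : X → Prop} :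
    (∀ᵐ x ∂(weightMeasure w), P x) ↔ ∀ x, P x := by
  let : MeasurableSpace X := ⊤
  refine ⟨fun h x => ?_, fun h => Eventually.of_forall h⟩
  by_contra hx
  have h1 : weightMeasure w {x} ≤ 0 := by
    rw [← ae_iff.mp h]
    exact measure_mono (by simpa using hx)
  rw [weightMeasure_singleton] at h1
  simp [(hw x).not_ge] at h1

/-- The square `∑ x, w x * |f x|²` of the norm of `f` in the weighted `ℓ²` space, as an extended
nonnegative number, so that no summability has to be assumed. -/
def energy (w : X → ℝ) (f : X → ℂ) : ℝ≥0∞ :=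
  ∑' x, ENNReal.ofReal (w x) * ‖f x‖ₑ ^ 2

theorem eLpNorm_sq_eq_energy (w : X → ℝ) (f : X → ℂ) :
    eLpNorm f 2 (weightMeasure w) ^ 2 = energy w f := by
  have h := eLpNorm_nnreal_pow_eq_lintegral (f := f) (μ := weightMeasure w) (p := 2) (by simp)
  rw [energy, ← lintegral_weightMeasure w]
  simpa using h

theorem enorm_sq_eq_energy (f : WeightedEll2 w) : ‖f‖ₑ ^ 2 = energy w f := by
  rw [Lp.enorm_def, eLpNorm_sq_eq_energy]

theorem exists_coe_eq_of_energy_lt_top (hw : ∀ x, 0 < w x) {f : X → ℂ} (hf : energy w f < ∞) :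
    ∃ F : WeightedEll2 w, (F : X → ℂ) = f := by
  let : MeasurableSpace X := ⊤
  have hmem : MemLp f 2 (weightMeasure w) := by
    refine ⟨(measurable_from_top (f := f)).aestronglyMeasurable, ?_⟩
    rw [← eLpNorm_sq_eq_energy] at hf
    by_contra h
    simp [not_lt_top_iff.mp h] at hf
  refine ⟨hmem.toLp f, funext ?_⟩
  exact (ae_weightMeasure_iff hw).mp hmem.coeFn_toLp

theorem coe_sub_apply (hw : ∀ x, 0 < w x) (f g : WeightedEll2 w) (x : X) :
    (f - g : WeightedEll2 w) x = f x - g x :=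
  (ae_weightMeasure_iff hw).mp (Lp.coeFn_sub f g) x

theorem coe_smul_apply (hw : ∀ x, 0 < w x) (c : ℂ) (f : WeightedEll2 w) (x : X) :
    (c • f : WeightedEll2 w) x = c * f x :=
  (ae_weightMeasure_iff hw).mp (Lp.coeFn_smul c f) x

/-- The operator `z - L` on functions is bounded below with respect to the weighted `ℓ²` norm. -/
def IsBoundedBelow (w : X → ℝ) (L : (X → ℂ) → X → ℂ) (z : ℂ) : Prop :=
  ∃ C : ℝ≥0, ∀ f : X → ℂ, energy w f < ∞ →
    energy w f ≤ C * energy w fun x => z * f x - L f x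

/-- For a self-adjoint operator, the spectrum is the approximate point spectrum. -/
theorem notMem_spectrum_iff_isBoundedBelow (hw : ∀ x, 0 < w x)
    {T : WeightedEll2 w →L[ℂ] WeightedEll2 w} {L : (X → ℂ) → X → ℂ} (hTL : ActsAs T L)
    (hT : IsSelfAdjoint T) (z : ℂ) : z ∉ spectrum ℂ T ↔ IsBoundedBelow w L z := by
  have hnormal : IsStarNormal (algebraMap ℂ (WeightedEll2 w →L[ℂ] WeightedEll2 w) z - T) := by
    have hT' : star T = T := hT
    refine ⟨?_⟩
    rw [Commute, SemiconjBy, star_sub, hT', ← algebraMap_star_comm]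
    simp only [sub_mul, mul_sub, Algebra.commutes, ← map_mul, mul_comm]
    abel
  have happly (f : WeightedEll2 w) :
      energy w (fun x => z * f x - L f x) =
        ‖(algebraMap ℂ (WeightedEll2 w →L[ℂ] WeightedEll2 w) z - T) f‖ₑ ^ 2 := by
    rw [enorm_sq_eq_energy]
    congr 1
    ext x
    rw [_root_.sub_apply, coe_sub_apply hw, hTL f x, Algebra.algebraMap_eq_smul_one,
      _root_.smul_apply, coe_smul_apply hw]
    rfl
  rw [spectrum.notMem_iff, isUnit_iff_antilipschitz_of_isStarNormal _ hnormal]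
  constructor
  · rintro ⟨c, hc⟩
    refine ⟨c ^ 2, fun f hf => ?_⟩
    obtain ⟨F, rfl⟩ := exists_coe_eq_of_energy_lt_top hw hf
    rw [happly, ← enorm_sq_eq_energy, ENNReal.coe_pow, ← mul_pow]
    have := hc F 0
    rw [map_zero, edist_zero_right, edist_zero_right] at this
    gcongr
  · rintro ⟨C, hC⟩
    refine ⟨NNReal.sqrt C, ?_⟩
    refine AddMonoidHomClass.antilipschitz_of_bound _ fun f => ?_
    have h := hC f (by rw [← enorm_sq_eq_energy]; exact ENNReal.pow_lt_top enorm_lt_top)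
    rw [happly, ← enorm_sq_eq_energy] at h
    have h' : ‖f‖ₑ ^ 2 ≤
        ((NNReal.sqrt C : ℝ≥0) *
          ‖(algebraMap ℂ (WeightedEll2 w →L[ℂ] WeightedEll2 w) z - T) f‖ₑ) ^ 2 := by
      rwa [mul_pow, ← ENNReal.coe_pow, NNReal.sq_sqrt]
    have h'' := (ENNReal.pow_le_pow_left_iff two_ne_zero).mp h'
    rw [enorm_eq_nnnorm, enorm_eq_nnnorm] at h''
    exact NNReal.coe_le_coe.mpr (by exact_mod_cast h'')

/-- The function that is `1` at `x` and vanishes elsewhere. -/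
def pointMass (w : X → ℝ) (x : X) : WeightedEll2 w :=
  indicatorConstLp (μ := weightMeasure w) 2 (s := {x}) MeasurableSpace.measurableSet_top
    (by rw [weightMeasure_singleton]; exact ENNReal.ofReal_ne_top) (1 : ℂ)

open Classical in
theorem coe_pointMass (hw : ∀ x, 0 < w x) (x : X) :
    (pointMass w x : X → ℂ) = Pi.single x 1 := by
  let : MeasurableSpace X := ⊤
  have h := (ae_weightMeasure_iff hw).mp (indicatorConstLp_coeFn (p := 2) (μ := weightMeasure w)
    (s := {x}) (hs := MeasurableSpace.measurableSet_top)
    (hμs := by rw [weightMeasure_singleton]; exact ENNReal.ofReal_ne_top) (c := (1 : ℂ)))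
  ext y
  refine (h y).trans ?_
  by_cases hy : y = x
  · subst hy; simp
  · simp [hy]

theorem inner_pointMass (hw : ∀ x, 0 < w x) (x : X) (f : WeightedEll2 w) :
    inner ℂ (pointMass w x) f = w x * f x := by
  let : MeasurableSpace X := ⊤
  rw [pointMass, L2.inner_indicatorConstLp_one, integral_singleton, measureReal_def,
    weightMeasure_singleton, ENNReal.toReal_ofReal (hw x).le, Complex.real_smul]

open Classical in
/-- The matrix of a self-adjoint operator is symmetric up to conjugation and the weights. -/
theorem weight_mul_apply_single (hw : ∀ x, 0 < w x)
    {T : WeightedEll2 w →L[ℂ] WeightedEll2 w} {L : (X → ℂ) → X → ℂ} (hTL : ActsAs T L)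
    (hT : IsSelfAdjoint T) (x y : X) :
    w x * L (Pi.single y 1) x = w y * starRingEnd ℂ (L (Pi.single x 1) y) := by
  have h := hT.isSymmetric (pointMass w x) (pointMass w y)
  have h1 := inner_pointMass hw x (T (pointMass w y))
  have h2 := inner_pointMass hw y (T (pointMass w x))
  rw [hTL, coe_pointMass hw] at h1 h2
  rw [← h1, ← Complex.conj_ofReal (w y), ← map_mul, ← h2, inner_conj_symm]
  exact h.symm

end WeightMeasure

/-! ### The pencil of a centrosymmetric Jacobi matrix -/

section Path

variable {n : ℕ} {A : Matrix (Fin (n + 1)) (Fin (n + 1)) ℂ}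

theorem IsCentrosymmetricJacobi.apply_rev (hA : IsCentrosymmetricJacobi A) (i j : Fin (n + 1)) :
    A i.rev j.rev = A i j :=
  congrFun (congrFun hA.centrosymmetric i) j

theorem IsCentrosymmetricJacobi.mulVec_comp_rev (hA : IsCentrosymmetricJacobi A)
    (w : Fin (n + 1) → ℂ) (k : Fin (n + 1)) : (A *ᵥ (w ∘ Fin.rev)) k = (A *ᵥ w) k.rev := by
  simp only [mulVec, dotProduct, Function.comp]
  refine Fintype.sum_equiv Fin.revPerm _ _ fun j => ?_
  simp [hA.apply_rev]

/-- The matrix `z - A` on functions on the path. -/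
def pencil (A : Matrix (Fin (n + 1)) (Fin (n + 1)) ℂ) (z : ℂ) (w : Fin (n + 1) → ℂ)
    (k : Fin (n + 1)) : ℂ :=
  z * w k - (A *ᵥ w) k

theorem IsCentrosymmetricJacobi.pencil_comp_rev (hA : IsCentrosymmetricJacobi A) (z : ℂ)
    (w : Fin (n + 1) → ℂ) (k : Fin (n + 1)) : pencil A z (w ∘ Fin.rev) k = pencil A z w k.rev := by
  simp [pencil, hA.mulVec_comp_rev]

theorem pencil_linearCombination (A : Matrix (Fin (n + 1)) (Fin (n + 1)) ℂ) (z a b : ℂ)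
    (v w : Fin (n + 1) → ℂ) (k : Fin (n + 1)) :
    pencil A z (fun i => a * v i + b * w i) k = a * pencil A z v k + b * pencil A z w k := by
  have h : (fun i => a * v i + b * w i) = a • v + b • w := rfl
  simp only [pencil, h, mulVec_add, mulVec_smul, Pi.add_apply, Pi.smul_apply, smul_eq_mul]
  ring

/-- The rows `0, …, n - 1` and columns `1, …, n` of `z - A`. -/
def superBlock (A : Matrix (Fin (n + 1)) (Fin (n + 1)) ℂ) (z : ℂ) : Matrix (Fin n) (Fin n) ℂ :=
  (z • (1 : Matrix (Fin (n + 1)) (Fin (n + 1)) ℂ) - A).submatrix Fin.castSucc Fin.succ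

theorem pencil_eq_mulVec (A : Matrix (Fin (n + 1)) (Fin (n + 1)) ℂ) (z : ℂ)
    (w : Fin (n + 1) → ℂ) :
    pencil A z w = (z • (1 : Matrix (Fin (n + 1)) (Fin (n + 1)) ℂ) - A) *ᵥ w := by
  ext k
  simp [pencil, sub_mulVec, smul_mulVec]

theorem pencil_castSucc (A : Matrix (Fin (n + 1)) (Fin (n + 1)) ℂ) (z : ℂ)
    (w : Fin (n + 1) → ℂ) (i : Fin n) :
    pencil A z w i.castSucc =
      w 0 * (z • (1 : Matrix (Fin (n + 1)) (Fin (n + 1)) ℂ) - A) i.castSucc 0 +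
      (superBlock A z *ᵥ (w ∘ Fin.succ)) i := by
  rw [pencil_eq_mulVec, mulVec, dotProduct, Fin.sum_univ_succ, mul_comm]
  rfl

theorem IsCentrosymmetricJacobi.det_superBlock (hA : IsCentrosymmetricJacobi A) (z : ℂ) :
    (superBlock A z).det = (-1) ^ n * upperProd A := by
  rw [det_of_isLowerTriangular]
  · have h (i : Fin n) : superBlock A z i i = -1 * A i.castSucc i.succ := by
      simp [superBlock, one_apply, Fin.ext_iff]
    simp only [h, Finset.prod_mul_distrib, upperProd]
    simp
  · intro i j hij
    have hij' : (i : ℕ) < j := hij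
    have h1 : i.castSucc ≠ j.succ := by simp [Fin.ext_iff]; omega
    simp [superBlock, one_apply, h1, hA.tridiagonal i.castSucc j.succ (by left; simp; omega)]

theorem upperProd_ne_zero (hA0 : ∀ i : Fin n, A i.castSucc i.succ ≠ 0) : upperProd A ≠ 0 :=
  Finset.prod_ne_zero_iff.mpr fun i _ => hA0 i

/-- The functions on the path which `z - A` maps to a multiple of the point mass at `n` are
determined by their value at `0`. -/
theorem IsCentrosymmetricJacobi.eq_zero_of_pencil_castSucc_eq_zero
    (hA : IsCentrosymmetricJacobi A) (hA0 : ∀ i : Fin n, A i.castSucc i.succ ≠ 0) {z : ℂ}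
    {w : Fin (n + 1) → ℂ} (h0 : w 0 = 0) (hw : ∀ i : Fin n, pencil A z w i.castSucc = 0) :
    w = 0 := by
  have hdet : (superBlock A z).det ≠ 0 := by
    rw [hA.det_superBlock]
    exact mul_ne_zero (by simp) (upperProd_ne_zero hA0)
  have h : w ∘ Fin.succ = 0 := by
    refine eq_zero_of_mulVec_eq_zero hdet (funext fun i => ?_)
    have := hw i
    rwa [pencil_castSucc, h0, zero_mul, zero_add] at this
  ext k
  refine Fin.cases h0 (fun i => congrFun h i) k

/-- By Cramer's rule, the value at `n` of the solution of `(z - A) w = c δ_n` with `w 0 = 1` is the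
quotient which occurs in `decimationFunction`. -/
theorem IsCentrosymmetricJacobi.exists_pencil_castSucc_eq_zero (hn : 1 ≤ n)
    (hA : IsCentrosymmetricJacobi A) (hA0 : ∀ i : Fin n, A i.castSucc i.succ ≠ 0) (z : ℂ) :
    ∃ w : Fin (n + 1) → ℂ, w 0 = 1 ∧ w (Fin.last n) = 1 - decimationFunction A z ∧
      ∀ i : Fin n, pencil A z w i.castSucc = 0 := by
  obtain ⟨m, rfl⟩ : ∃ m, n = m + 1 := ⟨n - 1, by omega⟩
  set N := superBlock A z with hN
  have hup := upperProd_ne_zero hA0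
  have hdet : N.det ≠ 0 := by
    rw [hN, hA.det_superBlock]
    exact mul_ne_zero (by simp) hup
  set col : Fin (m + 1) → ℂ := fun i =>
    (z • (1 : Matrix (Fin (m + 1 + 1)) (Fin (m + 1 + 1)) ℂ) - A) i.castSucc 0 with hcol
  set K := z • (1 : Matrix (Fin (m + 1)) (Fin (m + 1)) ℂ) - A.submatrix Fin.castSucc Fin.castSucc
    with hK
  -- Moving the column `0` of the leading principal block to the end gives the matrix in the
  -- numerator of Cramer's rule.
  have hperm : N.updateCol (Fin.last m) col = K.submatrix id (finRotate (m + 1)) := by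
    ext i j
    refine Fin.lastCases ?_ (fun j => ?_) j
    · have h1 : (i.castSucc = 0) = (i = 0) := by simp
      rw [updateCol_self, submatrix_apply, finRotate_last]
      simp only [hcol, hK, Matrix.sub_apply, Matrix.smul_apply, one_apply, h1, submatrix_apply,
        id_eq, Fin.castSucc_zero]
    · have hj : finRotate (m + 1) j.castSucc = j.succ := by
        rw [finRotate_apply]; simp
      rw [updateCol_ne (Fin.castSucc_lt_last j).ne, submatrix_apply, hj]
      simp [hN, hK, superBlock, one_apply, Fin.ext_iff]
  refine ⟨Fin.cons 1 (-(N.det)⁻¹ • N.cramer col), rfl, ?_, fun i => ?_⟩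
  · rw [← Fin.succ_last, Fin.cons_succ, Pi.smul_apply, cramer_apply, hperm, det_permute',
      sign_finRotate, hN, hA.det_superBlock, decimationFunction, leadingPoly]
    simp only [smul_eq_mul, Nat.add_sub_cancel, ← hK, pow_succ]
    field_simp
    push_cast
    ring
  · rw [pencil_castSucc, ← hN]
    have : (Fin.cons 1 (-(N.det)⁻¹ • N.cramer col) : Fin (m + 1 + 1) → ℂ) ∘ Fin.succ =
        -(N.det)⁻¹ • N.cramer col := rfl
    rw [this, mulVec_smul, mulVec_cramer, Fin.cons_zero]
    simp [hcol, hdet]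

/-- Let `R z ≠ 0, 2`. The function `φ` is the solution of the interior equations with boundary
values `1` and `0`. The boundary rows of `z - A` at `φ` are in the ratio `R z - 1`. The last part is
uniqueness for the interior equations with zero boundary values. -/
theorem IsCentrosymmetricJacobi.exists_dirichlet_solution (hn : 1 ≤ n)
    (hA : IsCentrosymmetricJacobi A) (hA0 : ∀ i : Fin n, A i.castSucc i.succ ≠ 0) {z : ℂ}
    (hz0 : decimationFunction A z ≠ 0) (hz2 : decimationFunction A z ≠ 2) :
    (∃ (φ : Fin (n + 1) → ℂ) (b : ℂ), b ≠ 0 ∧ φ 0 = 1 ∧ φ (Fin.last n) = 0 ∧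
      (∀ k, k ≠ 0 → k ≠ Fin.last n → pencil A z φ k = 0) ∧
      pencil A z φ 0 = (decimationFunction A z - 1) * b ∧ pencil A z φ (Fin.last n) = b) ∧
    ∀ w : Fin (n + 1) → ℂ, w 0 = 0 → w (Fin.last n) = 0 →
      (∀ k, k ≠ 0 → k ≠ Fin.last n → pencil A z w k = 0) → w = 0 := by
  obtain ⟨θ, hθ0, hθn, hθ⟩ := hA.exists_pencil_castSucc_eq_zero hn hA0 z
  set t := 1 - decimationFunction A z with ht
  have ht1 : 1 - t ^ 2 ≠ 0 := by
    have : 1 - t ^ 2 = decimationFunction A z * (2 - decimationFunction A z) := by rw [ht]; ring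
    rw [this]
    exact mul_ne_zero hz0 (sub_ne_zero.mpr hz2.symm)
  set c := pencil A z θ (Fin.last n) with hc
  have hrow (k : Fin (n + 1)) (hk : k ≠ Fin.last n) : pencil A z θ k = 0 := by
    obtain ⟨i, rfl⟩ := Fin.exists_castSucc_eq.mpr hk
    exact hθ i
  have hrow' (k : Fin (n + 1)) (hk : k ≠ 0) : pencil A z (θ ∘ Fin.rev) k = 0 := by
    rw [hA.pencil_comp_rev]
    exact hrow _ fun h => hk (by rw [← Fin.rev_rev k, h, Fin.rev_last])
  have hrow0 : pencil A z (θ ∘ Fin.rev) 0 = c := by rw [hA.pencil_comp_rev, Fin.rev_zero]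
  have h0n : (0 : Fin (n + 1)) ≠ Fin.last n := by
    intro h; simp [Fin.ext_iff] at h; omega
  -- Otherwise `θ` and its reflection would both be eigenvectors, hence proportional,
  -- and `t ^ 2 = 1`.
  have hc0 : c ≠ 0 := by
    intro h
    have hz : (fun i => 1 * (θ ∘ Fin.rev) i + (-t) * θ i) = 0 := by
      refine hA.eq_zero_of_pencil_castSucc_eq_zero hA0 (z := z) ?_ fun i => ?_
      · simp [hθ0, hθn]
      · rw [pencil_linearCombination, hθ]
        by_cases hi : i.castSucc = 0
        · rw [hi, hrow0, h]; simp
        · rw [hrow' _ hi]; simp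
    have := congrFun hz (Fin.last n)
    simp only [Function.comp, Fin.rev_last, hθ0, hθn, Pi.zero_apply] at this
    exact ht1 (by linear_combination this)
  refine ⟨⟨fun i => (1 - t ^ 2)⁻¹ * θ i + (-t * (1 - t ^ 2)⁻¹) * (θ ∘ Fin.rev) i,
    (1 - t ^ 2)⁻¹ * c, mul_ne_zero (inv_ne_zero ht1) hc0, ?_, ?_, fun k hk hk' => ?_, ?_, ?_⟩,
    fun w hw0 hwn hw => ?_⟩
  · simp only [Function.comp, Fin.rev_zero, hθ0, hθn]
    field_simp
    ring
  · simp only [Function.comp, Fin.rev_last, hθ0, hθn]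
    ring
  · rw [pencil_linearCombination, hrow k hk', hrow' k hk]; simp
  · rw [pencil_linearCombination, hrow 0 h0n, hrow0, ht]; ring
  · rw [pencil_linearCombination, hrow' _ h0n.symm]; simp [hc]
  · -- The multiple `d` of the reflection of `θ` removes the boundary term of `w` at `0`, so that
    -- the difference is a multiple of `θ`.
    set d := pencil A z w 0 / c with hd
    have hz : (fun i => 1 * w i + (-1) * (d * (θ ∘ Fin.rev) i + (-(d * t)) * θ i)) = 0 := by
      refine hA.eq_zero_of_pencil_castSucc_eq_zero hA0 (z := z) ?_ fun i => ?_
      · simp [hθ0, hθn, hw0]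
      · rw [pencil_linearCombination, pencil_linearCombination, hθ]
        by_cases hi : i.castSucc = 0
        · rw [hi, hrow0, hd]; field_simp; ring
        · rw [hrow' _ hi, hw _ hi (Fin.castSucc_lt_last i).ne]; simp
    have hd0 : d = 0 := by
      have := congrFun hz (Fin.last n)
      simp only [Function.comp, Fin.rev_last, hθ0, hθn, hwn, Pi.zero_apply] at this
      have h' : d * (1 - t ^ 2) = 0 := by linear_combination -this
      exact (mul_eq_zero.mp h').resolve_right ht1
    ext i
    simpa [hd0] using congrFun hz i

end Path

/-! ### Bounds for the elimination of the interior of a path -/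

theorem enorm_add_sq_le (x y : ℂ) : ‖x + y‖ₑ ^ 2 ≤ 2 * (‖x‖ₑ ^ 2 + ‖y‖ₑ ^ 2) := by
  have h : ‖x + y‖₊ ^ 2 ≤ 2 * (‖x‖₊ ^ 2 + ‖y‖₊ ^ 2) :=
    (pow_le_pow_left' (nnnorm_add_le x y) 2).trans (add_sq_le)
  simp only [enorm_eq_nnnorm]
  exact_mod_cast h

theorem enorm_weighted_sum_sq_le {ι : Type*} (s : Finset ι) (p : ι → ℝ) (hp : ∀ i ∈ s, 0 ≤ p i)
    (hp1 : ∑ i ∈ s, p i = 1) (d : ι → ℂ) :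
    ‖∑ i ∈ s, (p i : ℂ) * d i‖ₑ ^ 2 ≤ ∑ i ∈ s, ENNReal.ofReal (p i) * ‖d i‖ₑ ^ 2 := by
  have h : ‖∑ i ∈ s, (p i : ℂ) * d i‖ ^ 2 ≤ ∑ i ∈ s, p i * ‖d i‖ ^ 2 := by
    refine le_trans ?_ (Real.pow_arith_mean_le_arith_mean_pow s p (fun i => ‖d i‖) hp hp1
      (fun i _ => norm_nonneg _) 2)
    gcongr
    refine (norm_sum_le _ _).trans_eq (Finset.sum_congr rfl fun i hi => ?_)
    rw [norm_mul, Complex.norm_real, Real.norm_of_nonneg (hp i hi)]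
  have h' := ENNReal.ofReal_le_ofReal h
  rw [ENNReal.ofReal_sum_of_nonneg fun i hi => mul_nonneg (hp i hi) (sq_nonneg _),
    ENNReal.ofReal_pow (norm_nonneg _), ofReal_norm] at h'
  refine h'.trans_eq (Finset.sum_congr rfl fun i hi => ?_)
  rw [ENNReal.ofReal_mul (hp i hi), ENNReal.ofReal_pow (norm_nonneg _), ofReal_norm]

/-- A linear form which vanishes on the common kernel of finitely many others is bounded by
them. -/
theorem exists_enorm_sq_le_of_ker_le {ι E : Type*} [Fintype ι] [AddCommGroup E] [Module ℂ E]
    (L : ι → E →ₗ[ℂ] ℂ) (K : E →ₗ[ℂ] ℂ) (h : ∀ x, (∀ i, L i x = 0) → K x = 0) :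
    ∃ C : ℝ≥0, ∀ x, ‖K x‖ₑ ^ 2 ≤ C * ∑ i, ‖L i x‖ₑ ^ 2 := by
  have hmem : K ∈ Submodule.span ℂ (Set.range L) := by
    refine mem_span_of_iInf_ker_le_ker fun x hx => ?_
    simp only [Submodule.mem_iInf, LinearMap.mem_ker] at hx ⊢
    exact h x hx
  obtain ⟨c, rfl⟩ := (Submodule.mem_span_range_iff_exists_fun ℂ).mp hmem
  refine ⟨∑ i, ‖c i‖₊ ^ 2, fun x => ?_⟩
  have h1 : ‖∑ i, c i * L i x‖₊ ^ 2 ≤ (∑ i, ‖c i‖₊ ^ 2) * ∑ i, ‖L i x‖₊ ^ 2 := by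
    refine le_trans ?_ (Finset.sum_mul_sq_le_sq_mul_sq Finset.univ _ _)
    gcongr
    exact (nnnorm_sum_le _ _).trans_eq (by simp)
  have h2 : (∑ i, c i • L i) x = ∑ i, c i * L i x := by simp [LinearMap.sum_apply]
  rw [h2]
  simp only [enorm_eq_nnnorm]
  exact_mod_cast h1

section Path

variable {n : ℕ} {A : Matrix (Fin (n + 1)) (Fin (n + 1)) ℂ}

/-- Row `k` of `z - A`, as a linear form. -/
def pencilForm (A : Matrix (Fin (n + 1)) (Fin (n + 1)) ℂ) (z : ℂ) (k : Fin (n + 1)) :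
    (Fin (n + 1) → ℂ) →ₗ[ℂ] ℂ :=
  LinearMap.proj k ∘ₗ Matrix.mulVecLin (z • (1 : Matrix (Fin (n + 1)) (Fin (n + 1)) ℂ) - A)

theorem pencilForm_apply (A : Matrix (Fin (n + 1)) (Fin (n + 1)) ℂ) (z : ℂ) (k : Fin (n + 1))
    (w : Fin (n + 1) → ℂ) : pencilForm A z k w = pencil A z w k := by
  rw [pencil_eq_mulVec]; rfl

/-- The square norm of `(z - A) w` on the interior of the path. -/
def interiorEnergy (A : Matrix (Fin (n + 1)) (Fin (n + 1)) ℂ) (z : ℂ) (w : Fin (n + 1) → ℂ) :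
    ℝ≥0∞ :=
  ∑ k : Interior n, ‖pencil A z w k‖ₑ ^ 2

/-- Reflection of the interior of the path. -/
def interiorRev (n : ℕ) : Interior n ≃ Interior n :=
  Fin.revPerm.subtypeEquiv fun k => by
    rw [Fin.revPerm_apply, ne_eq, ne_eq, ne_eq, ne_eq, Fin.rev_eq_iff, Fin.rev_eq_iff,
      Fin.rev_zero, Fin.rev_last, and_comm]

theorem IsCentrosymmetricJacobi.interiorEnergy_comp_rev (hA : IsCentrosymmetricJacobi A) (z : ℂ)
    (w : Fin (n + 1) → ℂ) : interiorEnergy A z (w ∘ Fin.rev) = interiorEnergy A z w := by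
  refine Fintype.sum_equiv (interiorRev n) _ _ fun k => ?_
  rw [hA.pencil_comp_rev]
  rfl

/-- Data for eliminating the interior of the path from the equation `(z - A) w = h`, available
when `R z ≠ 0, 2`: the solution `φ` with boundary values `1` and `0`, and bounds for the solution
and for the error in the boundary row in terms of `h` and the boundary values. -/
theorem IsCentrosymmetricJacobi.exists_elimination (hn : 1 ≤ n)
    (hA : IsCentrosymmetricJacobi A) (hA0 : ∀ i : Fin n, A i.castSucc i.succ ≠ 0) {z : ℂ}
    (hz0 : decimationFunction A z ≠ 0) (hz2 : decimationFunction A z ≠ 2) :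
    ∃ (φ : Fin (n + 1) → ℂ) (b : ℂ) (C : ℝ≥0), b ≠ 0 ∧ φ 0 = 1 ∧ φ (Fin.last n) = 0 ∧
      (∀ k, k ≠ 0 → k ≠ Fin.last n → pencil A z φ k = 0) ∧
      pencil A z φ 0 = (decimationFunction A z - 1) * b ∧ pencil A z φ (Fin.last n) = b ∧
      (∀ w k, ‖w k‖ₑ ^ 2 ≤ C * (‖w 0‖ₑ ^ 2 + ‖w (Fin.last n)‖ₑ ^ 2 + interiorEnergy A z w)) ∧
      ∀ w, ‖pencil A z w 0 - ((decimationFunction A z - 1) * b * w 0 + b * w (Fin.last n))‖ₑ ^ 2 ≤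
        C * interiorEnergy A z w := by
  obtain ⟨⟨φ, b, hb, hφ0, hφn, hφ, hr0, hrn⟩, hinj⟩ := hA.exists_dirichlet_solution hn hA0 hz0 hz2
  have hbound (k : Fin (n + 1)) : ∃ C : ℝ≥0, ∀ w : Fin (n + 1) → ℂ, ‖w k‖ₑ ^ 2 ≤
      C * (‖w 0‖ₑ ^ 2 + ‖w (Fin.last n)‖ₑ ^ 2 + interiorEnergy A z w) := by
    obtain ⟨C, hC⟩ := exists_enorm_sq_le_of_ker_le (ι := Bool ⊕ Interior n)
      (Sum.elim (fun i => LinearMap.proj (bif i then (0 : Fin (n + 1)) else Fin.last n))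
        fun k => pencilForm A z k)
      (LinearMap.proj k : (Fin (n + 1) → ℂ) →ₗ[ℂ] ℂ) fun w hw => by
        refine congrFun (hinj w (hw (Sum.inl true)) (hw (Sum.inl false)) fun j hj hj' => ?_) k
        rw [← pencilForm_apply]
        exact hw (Sum.inr ⟨j, hj, hj'⟩)
    refine ⟨C, fun w => ?_⟩
    have := hC w
    simpa [Fintype.sum_sum_type, pencilForm_apply, interiorEnergy] using this
  choose C hC using hbound
  obtain ⟨C', hC'⟩ := exists_enorm_sq_le_of_ker_le (fun k : Interior n => pencilForm A z k)
    (pencilForm A z 0 - (((decimationFunction A z - 1) * b) • LinearMap.proj 0 +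
      b • LinearMap.proj (Fin.last n))) fun w hw => by
    have h0 : (fun i => 1 * w i + (-1) * (w 0 * φ i + w (Fin.last n) * (φ ∘ Fin.rev) i)) = 0 := by
      refine hinj _ (by simp [hφ0, hφn]) (by simp [hφ0, hφn]) fun k hk hk' => ?_
      have hk1 : k.rev ≠ 0 := fun h => hk' (by rw [← Fin.rev_rev k, h, Fin.rev_zero])
      have hk2 : k.rev ≠ Fin.last n := fun h => hk (by rw [← Fin.rev_rev k, h, Fin.rev_last])
      rw [pencil_linearCombination, pencil_linearCombination, ← pencilForm_apply A z k w,
        hw ⟨k, hk, hk'⟩, hφ k hk hk', hA.pencil_comp_rev, hφ _ hk1 hk2]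
      simp
    have h1 : pencil A z
        (fun i => 1 * w i + (-1) * (w 0 * φ i + w (Fin.last n) * (φ ∘ Fin.rev) i)) 0 = 0 := by
      rw [h0, pencil_eq_mulVec, mulVec_zero]; rfl
    rw [pencil_linearCombination, pencil_linearCombination, hA.pencil_comp_rev, Fin.rev_zero, hr0,
      hrn] at h1
    simp only [LinearMap.sub_apply, LinearMap.add_apply, LinearMap.smul_apply, pencilForm_apply,
      LinearMap.proj_apply, smul_eq_mul]
    linear_combination h1
  refine ⟨φ, b, C' + ∑ k, C k, hb, hφ0, hφn, hφ, hr0, hrn, fun w k => (hC k w).trans ?_,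
    fun w => le_trans ?_ ((hC' w).trans ?_)⟩
  · gcongr
    exact (Finset.single_le_sum (f := C) (fun _ _ => zero_le) (Finset.mem_univ k)).trans
      le_add_self
  · simp [pencilForm_apply]
  · simp only [pencilForm_apply, interiorEnergy]
    gcongr
    exact le_self_add

theorem sum_eq_boundary_add_interior (hn : 1 ≤ n) {M : Type*} [AddCommMonoid M]
    (F : Fin (n + 1) → M) :
    ∑ k, F k = F 0 + F (Fin.last n) + ∑ k : Interior n, F k := by
  have h0n : (0 : Fin (n + 1)) ≠ Fin.last n := by
    intro h; simp [Fin.ext_iff] at h; omega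
  rw [← Finset.sum_pair h0n, ← Finset.sum_subtype ({0, Fin.last n}ᶜ) (by simp) F,
    Finset.sum_add_sum_compl]

theorem IsCentrosymmetricJacobi.apply_succ_castSucc (hA : IsCentrosymmetricJacobi A) (i : Fin n) :
    A i.succ i.castSucc = A i.rev.castSucc i.rev.succ := by
  rw [← hA.apply_rev, Fin.rev_succ, Fin.rev_castSucc]

/-- The weights which symmetrize `A` up to conjugation, normalized to `1` at `0`. By
centrosymmetry they are `1` at `n` as well. -/
theorem IsCentrosymmetricJacobi.exists_weights (hA : IsCentrosymmetricJacobi A)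
    (hA0 : ∀ i : Fin n, A i.castSucc i.succ ≠ 0) :
    ∃ m : Fin (n + 1) → ℝ, (∀ k, 0 < m k) ∧ m 0 = 1 ∧ m (Fin.last n) = 1 ∧
      ∀ i : Fin n, m i.castSucc * ‖A i.castSucc i.succ‖ = m i.succ * ‖A i.succ i.castSucc‖ := by
  have hpos (i : Fin n) : 0 < ‖A i.castSucc i.succ‖ := norm_pos_iff.mpr (hA0 i)
  have hpos' (i : Fin n) : 0 < ‖A i.succ i.castSucc‖ := by rw [hA.apply_succ_castSucc]; exact hpos _
  set r : Fin n → ℝ := fun i => ‖A i.castSucc i.succ‖ / ‖A i.succ i.castSucc‖ with hr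
  refine ⟨Fin.partialProd r, fun k => ?_, Fin.partialProd_zero r, ?_, fun i => ?_⟩
  · refine Fin.induction (by simp) (fun i hi => ?_) k
    rw [Fin.partialProd_succ]
    exact mul_pos hi (div_pos (hpos i) (hpos' i))
  · have : Fin.partialProd r (Fin.last n) = ∏ i, r i := by
      rw [Fin.partialProd, List.take_of_length_le (by simp), List.prod_ofFn]
    rw [this, hr, Finset.prod_div_distrib,
      div_eq_one_iff_eq (Finset.prod_pos fun i _ => hpos' i).ne']
    refine Fintype.prod_equiv Fin.revPerm _ _ fun i => ?_
    rw [hA.apply_succ_castSucc, Fin.revPerm_apply, Fin.rev_rev]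
  · rw [Fin.partialProd_succ, hr, mul_assoc, div_mul_cancel₀ _ (hpos' i).ne']

end Path

/-! ### Edges and paths of the substitution graph -/

section Edges

variable {V : Type*} {G : SimpleGraph V}

theorem mk_source_target (e : G.edgeSet) : s(source e, target e) = e.1 :=
  Quot.out_eq e.1

theorem adj_source_target (e : G.edgeSet) : G.Adj (source e) (target e) := by
  rw [← SimpleGraph.mem_edgeSet, mk_source_target]; exact e.2

theorem source_ne_target (e : G.edgeSet) : source e ≠ target e := (adj_source_target e).ne

theorem exists_edge_of_adj {u v : V} (h : G.Adj u v) :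
    ∃ e : G.edgeSet, (u = source e ∧ v = target e) ∨ (u = target e ∧ v = source e) := by
  refine ⟨⟨s(u, v), h⟩, ?_⟩
  have := mk_source_target (⟨s(u, v), h⟩ : G.edgeSet)
  rcases Sym2.eq_iff.mp this with h | h
  · exact Or.inl ⟨h.1.symm, h.2.symm⟩
  · exact Or.inr ⟨h.2.symm, h.1.symm⟩

/-- A sum over oriented edges, as a sum over vertices and as a sum over edges. -/
theorem tsum_sum_neighborFinset [G.LocallyFinite] (F : V → V → ℝ≥0∞) :
    ∑' u, ∑ v ∈ G.neighborFinset u, F u v =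
      ∑' e : G.edgeSet, (F (source e) (target e) + F (target e) (source e)) := by
  classical
  let o : G.edgeSet × Bool → V × V := fun i =>
    bif i.2 then (source i.1, target i.1) else (target i.1, source i.1)
  have ho : Function.Injective o := by
    rintro ⟨e, b⟩ ⟨e', b'⟩ h
    have he (i : G.edgeSet × Bool) : s((o i).1, (o i).2) = i.1.1 := by
      rcases i with ⟨i, _ | _⟩
      · exact Sym2.eq_swap.trans (mk_source_target i)
      · exact mk_source_target i
    have hee : e = e' := Subtype.ext (by rw [← he (e, b), ← he (e', b'), h])
    subst hee
    have := source_ne_target e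
    cases b <;> cases b' <;> simp_all [o]
  have h1 (u : V) : ∑ v ∈ G.neighborFinset u, F u v = ∑' v, if G.Adj u v then F u v else 0 := by
    rw [tsum_eq_sum (s := G.neighborFinset u)]
    · refine Finset.sum_congr rfl fun v hv => ?_
      rw [if_pos (by simpa using hv)]
    · intro v hv
      rw [if_neg (by simpa using hv)]
  simp_rw [h1]
  rw [← ENNReal.tsum_prod (f := fun u v => if G.Adj u v then F u v else 0),
    ← ho.tsum_eq, ENNReal.tsum_prod (f := fun e b =>
      if G.Adj (o (e, b)).1 (o (e, b)).2 then F (o (e, b)).1 (o (e, b)).2 else 0)]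
  · refine tsum_congr fun e => ?_
    rw [tsum_fintype, Fintype.sum_bool]
    simp [o, adj_source_target e, (adj_source_target e).symm]
  · rintro ⟨u, v⟩ huv
    have hadj : G.Adj u v := by
      by_contra h
      simp [h] at huv
    obtain ⟨e, ⟨rfl, rfl⟩ | ⟨rfl, rfl⟩⟩ := exists_edge_of_adj hadj
    · exact ⟨(e, true), rfl⟩
    · exact ⟨(e, false), rfl⟩

end Edges

section Substitution

variable {V : Type*} {G : SimpleGraph V} {n : ℕ}

/-- The copy of the path graph which replaces the edge `e`. -/
def edgePath (e : G.edgeSet) (k : Fin (n + 1)) : SubstVertex G n :=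
  if h0 : k = 0 then Sum.inl (source e)
  else if hn : k = Fin.last n then Sum.inl (target e)
  else Sum.inr (e, ⟨k, h0, hn⟩)

@[simp]
theorem edgePath_zero (e : G.edgeSet) : edgePath e (0 : Fin (n + 1)) = Sum.inl (source e) := by
  simp [edgePath]

theorem zero_ne_last (hn : 1 ≤ n) : (0 : Fin (n + 1)) ≠ Fin.last n := by
  intro h; simp [Fin.ext_iff] at h; omega

theorem edgePath_last (hn : 1 ≤ n) (e : G.edgeSet) :
    edgePath e (Fin.last n) = Sum.inl (target e) := by
  simp [edgePath, (zero_ne_last hn).symm]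

@[simp]
theorem edgePath_interior (e : G.edgeSet) (k : Interior n) :
    edgePath e (k : Fin (n + 1)) = Sum.inr (e, k) := by
  simp [edgePath, k.2.1, k.2.2]

theorem path_cases (k : Fin (n + 1)) : k = 0 ∨ k = Fin.last n ∨ ∃ j : Interior n, k = j := by
  by_cases hk : k = 0
  · exact Or.inl hk
  by_cases hk' : k = Fin.last n
  · exact Or.inr (Or.inl hk')
  exact Or.inr (Or.inr ⟨⟨k, hk, hk'⟩, rfl⟩)

open Classical in
/-- The restriction of `g` to the path which replaces the edge `{u, v}`, read from `u` to `v`. -/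
def pathPull (g : SubstVertex G n → ℂ) (u v : V) : Fin (n + 1) → ℂ :=
  if h : G.Adj u v then
    if u = source (⟨s(u, v), h⟩ : G.edgeSet) then g ∘ edgePath ⟨s(u, v), h⟩
    else g ∘ edgePath ⟨s(u, v), h⟩ ∘ Fin.rev
  else 0

theorem pathPull_source_target (g : SubstVertex G n → ℂ) (e : G.edgeSet) :
    pathPull g (source e) (target e) = g ∘ edgePath e := by
  have he : (⟨s(source e, target e), adj_source_target e⟩ : G.edgeSet) = e :=
    Subtype.ext (mk_source_target e)
  rw [pathPull, dif_pos (adj_source_target e), he, if_pos rfl]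

theorem pathPull_target_source (g : SubstVertex G n → ℂ) (e : G.edgeSet) :
    pathPull g (target e) (source e) = (g ∘ edgePath e) ∘ Fin.rev := by
  have he : (⟨s(target e, source e), (adj_source_target e).symm⟩ : G.edgeSet) = e :=
    Subtype.ext (Sym2.eq_swap.trans (mk_source_target e))
  rw [pathPull, dif_pos (adj_source_target e).symm, he, if_neg (source_ne_target e).symm]
  rfl

theorem pathPull_zero (hn : 1 ≤ n) (g : SubstVertex G n → ℂ) {u v : V} (h : G.Adj u v) :
    pathPull g u v 0 = g (Sum.inl u) := by
  obtain ⟨e, ⟨rfl, rfl⟩ | ⟨rfl, rfl⟩⟩ := exists_edge_of_adj h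
  · simp [pathPull_source_target]
  · simp [pathPull_target_source, edgePath_last hn]

theorem pathPull_last (hn : 1 ≤ n) (g : SubstVertex G n → ℂ) {u v : V} (h : G.Adj u v) :
    pathPull g u v (Fin.last n) = g (Sum.inl v) := by
  obtain ⟨e, ⟨rfl, rfl⟩ | ⟨rfl, rfl⟩⟩ := exists_edge_of_adj h
  · simp [pathPull_source_target, edgePath_last hn]
  · simp [pathPull_target_source]

theorem edgePath_injective (hn : 1 ≤ n) (e : G.edgeSet) :
    Function.Injective (edgePath e : Fin (n + 1) → SubstVertex G n) := by
  intro i j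
  have h := source_ne_target e
  have h' := h.symm
  rcases path_cases i with rfl | rfl | ⟨i, rfl⟩ <;> rcases path_cases j with rfl | rfl | ⟨j, rfl⟩
    <;> simp [edgePath_last hn, h, h', Subtype.ext_iff]

variable {A : Matrix (Fin (n + 1)) (Fin (n + 1)) ℂ}

theorem substJacobi_interior (hn : 1 ≤ n) (p : V → V → ℝ) (e : G.edgeSet) (i : Interior n)
    (j : Fin (n + 1)) : substJacobi G p A (Sum.inr (e, i)) (edgePath e j) = A i j := by
  rcases path_cases j with rfl | rfl | ⟨j, rfl⟩
  · simp [substJacobi]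
  · simp [substJacobi, edgePath_last hn, (source_ne_target e).symm]
  · simp [substJacobi]

theorem substJacobi_interior_eq_zero (hn : 1 ≤ n) (p : V → V → ℝ) (e : G.edgeSet) (i : Interior n)
    {y : SubstVertex G n} (hy : y ∉ Set.range (edgePath e)) :
    substJacobi G p A (Sum.inr (e, i)) y = 0 := by
  rcases y with v | ⟨e', j⟩
  · have h1 : v ≠ source e := by rintro rfl; exact hy ⟨0, by simp⟩
    have h2 : v ≠ target e := by rintro rfl; exact hy ⟨Fin.last n, edgePath_last hn e⟩
    simp [substJacobi, h1, h2]
  · have h1 : e ≠ e' := by rintro rfl; exact hy ⟨j, by simp⟩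
    simp [substJacobi, h1]

theorem matrixAction_interior (hn : 1 ≤ n) (p : V → V → ℝ) (g : SubstVertex G n → ℂ)
    (e : G.edgeSet) (i : Interior n) :
    matrixAction (substJacobi G p A) g (Sum.inr (e, i)) = (A *ᵥ (g ∘ edgePath e)) i := by
  classical
  rw [matrixAction, finsum_eq_sum_of_support_subset (s := Finset.univ.image (edgePath e)),
    Finset.sum_image (edgePath_injective hn e).injOn]
  · simp [mulVec, dotProduct, substJacobi_interior hn]
  · intro y hy
    by_contra h
    refine hy ?_
    simp only []
    rw [substJacobi_interior_eq_zero hn p e i (by simpa using h), zero_mul]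

/-- In the interior of an edge, `z - J` acts as `z - A` on the restriction to the path. -/
theorem sub_matrixAction_interior (hn : 1 ≤ n) (p : V → V → ℝ) (z : ℂ) (g : SubstVertex G n → ℂ)
    (e : G.edgeSet) (i : Interior n) :
    z * g (Sum.inr (e, i)) - matrixAction (substJacobi G p A) g (Sum.inr (e, i)) =
      pencil A z (g ∘ edgePath e) i := by
  rw [matrixAction_interior hn, pencil, Function.comp_apply, edgePath_interior]

/-- The edge `{u, v}`, where `v` is a neighbour of `u`. -/
def neighborEdge (G : SimpleGraph V) [G.LocallyFinite] (u : V) (v : G.neighborFinset u) :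
    G.edgeSet :=
  ⟨s(u, v), (G.mem_neighborFinset u v).mp v.2⟩

/-- The interior part of the row of `J` at `u`, in the direction of the neighbour `v`. -/
theorem substJacobi_vertex_interior [G.LocallyFinite] (hA : IsCentrosymmetricJacobi A)
    (p : V → V → ℝ) (g : SubstVertex G n → ℂ) {u v : V} {e : G.edgeSet} (he : e.1 = s(u, v)) :
    ∑ j : Interior n, substJacobi G p A (Sum.inl u) (Sum.inr (e, j)) * g (Sum.inr (e, j)) =
      p u v * ∑ j : Interior n, A 0 j * pathPull g u v j := by
  rw [Finset.mul_sum]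
  rw [← mk_source_target] at he
  rcases Sym2.eq_iff.mp he with ⟨rfl, rfl⟩ | ⟨rfl, rfl⟩
  · refine Finset.sum_congr rfl fun j _ => ?_
    simp [substJacobi, pathPull_source_target, mul_assoc]
  · refine Fintype.sum_equiv (interiorRev n) _ _ fun j => ?_
    have h1 : ((interiorRev n j : Interior n) : Fin (n + 1)) = (j : Fin (n + 1)).rev := rfl
    have h2 : A 0 (j : Fin (n + 1)).rev = A (Fin.last n) j := by
      rw [← hA.apply_rev, Fin.rev_zero, Fin.rev_rev]
    simp [substJacobi, pathPull_target_source, h1, h2, (source_ne_target e).symm, mul_assoc]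

/-- The row of `z - J` at a vertex of `G` is the mean, with respect to the transition probabilities,
of the boundary rows of `z - A` on the adjacent paths. -/
theorem sub_matrixAction_vertex [G.LocallyFinite] (hn : 1 ≤ n) (hA : IsCentrosymmetricJacobi A)
    {p : V → V → ℝ} (hp : IsTransitionProbability G p) (z : ℂ) (g : SubstVertex G n → ℂ) (u : V) :
    z * g (Sum.inl u) - matrixAction (substJacobi G p A) g (Sum.inl u) =
      ∑ v ∈ G.neighborFinset u, (p u v : ℂ) * pencil A z (pathPull g u v) 0 := by
  classical
  have hp1 : ∑ v ∈ G.neighborFinset u, (p u v : ℂ) = 1 := by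
    rw [← Complex.ofReal_sum, hp.sum_eq_one, Complex.ofReal_one]
  have hinj : Function.Injective (neighborEdge G u) := by
    intro v v' h
    have h' : s(u, (v : V)) = s(u, (v' : V)) := congrArg Subtype.val h
    exact Subtype.ext (Sym2.congr_right.mp h')
  have hu : u ∉ G.neighborFinset u := by simp
  have hrow : matrixAction (substJacobi G p A) g (Sum.inl u) = A 0 0 * g (Sum.inl u) +
      ∑ v ∈ G.neighborFinset u, p u v *
        (A 0 (Fin.last n) * g (Sum.inl v) + ∑ j : Interior n, A 0 j * pathPull g u v j) := by
    rw [matrixAction, finsum_eq_sum_of_support_subset (s := (insert u (G.neighborFinset u)).disjSum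
      ((Finset.univ.image (neighborEdge G u)) ×ˢ (Finset.univ : Finset (Interior n)))),
      Finset.sum_disjSum, Finset.sum_product, Finset.sum_image hinj.injOn, Finset.sum_insert hu]
    · have h1 : ∑ v ∈ G.neighborFinset u,
          substJacobi G p A (Sum.inl u) (Sum.inl v) * g (Sum.inl v) =
          ∑ v ∈ G.neighborFinset u, p u v * (A 0 (Fin.last n) * g (Sum.inl v)) := by
        refine Finset.sum_congr rfl fun v hv => ?_
        have : u ≠ v := by rintro rfl; exact hu hv
        simp [substJacobi, this, mul_assoc]
      have h2 : ∑ v : G.neighborFinset u, ∑ j : Interior n,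
          substJacobi G p A (Sum.inl u) (Sum.inr (neighborEdge G u v, j)) *
            g (Sum.inr (neighborEdge G u v, j)) =
          ∑ v ∈ G.neighborFinset u, p u v * ∑ j : Interior n, A 0 j * pathPull g u v j := by
        rw [← Finset.sum_coe_sort (G.neighborFinset u)]
        exact Finset.sum_congr rfl fun v _ =>
          substJacobi_vertex_interior (e := neighborEdge G u v) hA p g rfl
      rw [h1, h2]
      simp only [substJacobi, if_true, mul_add, Finset.sum_add_distrib, add_assoc]
    · intro y hy
      by_contra h
      refine hy ?_
      rcases y with v | ⟨e, j⟩
      · rw [Finset.mem_coe, Finset.inl_mem_disjSum, Finset.mem_insert, not_or] at h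
        have h3 : p u v = 0 := by rw [← hp.not_adj_iff]; simpa using h.2
        simp [substJacobi, (Ne.symm h.1 : u ≠ v), h3]
      · have h4 (v : V) (hv : G.Adj u v) (he : e.1 = s(u, v)) : False := by
          refine h ?_
          rw [Finset.mem_coe, Finset.inr_mem_disjSum, Finset.mem_product, Finset.mem_image]
          exact ⟨⟨⟨v, (G.mem_neighborFinset u v).mpr hv⟩, Finset.mem_univ _, Subtype.ext he.symm⟩,
            Finset.mem_univ _⟩
        have h5 : u ≠ source e := by
          rintro rfl
          exact h4 _ (adj_source_target e) (mk_source_target e).symm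
        have h6 : u ≠ target e := by
          rintro rfl
          exact h4 _ (adj_source_target e).symm ((mk_source_target e).symm.trans Sym2.eq_swap)
        simp [substJacobi, h5, h6]
  have hpen (v : V) (hv : v ∈ G.neighborFinset u) :
      pencil A z (pathPull g u v) 0 = z * g (Sum.inl u) - A 0 0 * g (Sum.inl u) -
        (A 0 (Fin.last n) * g (Sum.inl v) + ∑ j : Interior n, A 0 j * pathPull g u v j) := by
    have hadj : G.Adj u v := by simpa using hv
    rw [pencil, mulVec, dotProduct, sum_eq_boundary_add_interior hn, pathPull_zero hn g hadj,
      pathPull_last hn g hadj]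
    ring
  rw [Finset.sum_congr rfl fun v hv => by rw [hpen v hv, mul_sub], Finset.sum_sub_distrib,
    ← Finset.sum_mul, hp1, hrow]
  ring

/-- Within a copy of the path, the off-diagonal entries are those of `A`, with an additional
factor in the rows of the endpoints. -/
theorem substJacobi_edgePath (hn : 1 ≤ n) (hA : IsCentrosymmetricJacobi A) (p : V → V → ℝ)
    (e : G.edgeSet) {i j : Fin (n + 1)} (hij : i ≠ j) :
    substJacobi G p A (edgePath e i) (edgePath e j) =
      ((if i = 0 then p (source e) (target e)
        else if i = Fin.last n then p (target e) (source e) else 1 : ℝ) : ℂ) * A i j := by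
  have h := source_ne_target e
  have h' := h.symm
  have hl := (zero_ne_last hn).symm
  have hA' : A (Fin.last n) 0 = A 0 (Fin.last n) := by
    rw [← hA.apply_rev, Fin.rev_zero, Fin.rev_last]
  rcases path_cases i with rfl | rfl | ⟨i, rfl⟩
  · rcases path_cases j with rfl | rfl | ⟨j, rfl⟩
    · exact absurd rfl hij
    all_goals simp [edgePath_last hn, substJacobi, h]
  · rcases path_cases j with rfl | rfl | ⟨j, rfl⟩
    · simp [edgePath_last hn, substJacobi, h', hl, hA']
    · exact absurd rfl hij
    · simp [edgePath_last hn, substJacobi, h', hl]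
  · rw [edgePath_interior, substJacobi_interior hn]
    simp [i.2.1, i.2.2]

end Substitution

/-! ### Weights -/

section Weights

variable {V : Type*} {G : SimpleGraph V} {n : ℕ} {A : Matrix (Fin (n + 1)) (Fin (n + 1)) ℂ}

theorem IsTransitionProbability.pos [G.LocallyFinite] {p : V → V → ℝ}
    (hp : IsTransitionProbability G p) {u v : V} (h : G.Adj u v) : 0 < p u v :=
  ((hp.adj_iff u v).mp h).1

theorem IsTransitionProbability.nonneg [G.LocallyFinite] {p : V → V → ℝ}
    (hp : IsTransitionProbability G p) (u v : V) : 0 ≤ p u v := by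
  by_cases h : G.Adj u v
  · exact (hp.pos h).le
  · exact ((hp.not_adj_iff u v).mp h).ge

open Classical in
theorem matrixAction_single {X : Type*} (B : X → X → ℂ) (x y : X) :
    matrixAction B (Pi.single y 1) x = B x y := by
  rw [matrixAction, finsum_eq_single _ y]
  · simp
  · intro y' hy'
    simp [hy']

/-- Detailed balance for a self-adjoint probabilistic Laplacian. -/
theorem weight_mul_transition_comm [G.LocallyFinite] {p : V → V → ℝ}
    {w : V → ℝ} (hw : ∀ x, 0 < w x)
    {D : WeightedEll2 w →L[ℂ] WeightedEll2 w} (hD : ActsAs D (probLaplacian G p))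
    (hDsa : IsSelfAdjoint D) {u v : V} (h : G.Adj u v) : w u * p u v = w v * p v u := by
  classical
  have key {x y : V} (hxy : G.Adj x y) :
      probLaplacian G p (Pi.single y 1) x = -(p x y : ℂ) := by
    rw [probLaplacian, Finset.sum_eq_single_of_mem y (by simpa using hxy)]
    · simp [hxy.ne]
    · intro b _ hb
      simp [hb]
  have := weight_mul_apply_single hw hD hDsa u v
  rw [key h, key h.symm, map_neg, Complex.conj_ofReal] at this
  have h' : (w u : ℂ) * p u v = w v * p v u := by linear_combination -this
  exact_mod_cast h'

/-- Self-adjointness of `J` determines the weights in the interior of each copy of the path from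
the weights at its endpoints, which satisfy detailed balance. -/
theorem exists_weight_interior [G.LocallyFinite] {p : V → V → ℝ}
    (hp : IsTransitionProbability G p) (hn : 1 ≤ n) (hA : IsCentrosymmetricJacobi A)
    (hA0 : ∀ i : Fin n, A i.castSucc i.succ ≠ 0) {w : SubstVertex G n → ℝ} (hw : ∀ x, 0 < w x)
    {J : WeightedEll2 w →L[ℂ] WeightedEll2 w} (hJ : ActsAs J (matrixAction (substJacobi G p A)))
    (hJsa : IsSelfAdjoint J) :
    ∃ m : Interior n → ℝ, (∀ k, 0 < m k) ∧ ∀ e : G.edgeSet,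
      w (Sum.inl (source e)) * p (source e) (target e) =
        w (Sum.inl (target e)) * p (target e) (source e) ∧
      ∀ k, w (Sum.inr (e, k)) = w (Sum.inl (source e)) * p (source e) (target e) * m k := by
  classical
  obtain ⟨m, hm, hm0, hmn, hms⟩ := hA.exists_weights hA0
  refine ⟨fun k => m k, fun k => hm k, fun e => ?_⟩
  set c : Fin (n + 1) → ℝ := fun i => if i = 0 then p (source e) (target e)
    else if i = Fin.last n then p (target e) (source e) else 1 with hc
  have hcpos (i : Fin (n + 1)) : 0 ≤ c i := by
    rw [hc]; dsimp only; split_ifs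
    exacts [hp.nonneg _ _, hp.nonneg _ _, zero_le_one]
  -- The weights along the path, corrected by `c` at the endpoints, satisfy the recurrence of `m`.
  have hstep (i : Fin n) : w (edgePath e i.castSucc) * c i.castSucc * ‖A i.castSucc i.succ‖ =
      w (edgePath e i.succ) * c i.succ * ‖A i.succ i.castSucc‖ := by
    have hne : i.castSucc ≠ i.succ := (Fin.castSucc_lt_succ).ne
    have h := weight_mul_apply_single hw hJ hJsa (edgePath e i.castSucc) (edgePath e i.succ)
    rw [matrixAction_single, matrixAction_single, substJacobi_edgePath hn hA p e hne,
      substJacobi_edgePath hn hA p e hne.symm] at h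
    have h' := congrArg norm h
    simp only [norm_mul, RCLike.norm_conj, Complex.norm_real, Real.norm_of_nonneg (hw _).le] at h'
    rw [Real.norm_of_nonneg (hcpos i.castSucc), Real.norm_of_nonneg (hcpos i.succ)] at h'
    rw [mul_assoc, mul_assoc]
    exact h'
  have hq (k : Fin (n + 1)) : w (edgePath e k) * c k =
      w (Sum.inl (source e)) * p (source e) (target e) * m k := by
    refine Fin.induction ?_ (fun i hi => ?_) k
    · simp [hc, hm0]
    · have hne : ‖A i.succ i.castSucc‖ ≠ 0 := by
        rw [hA.apply_succ_castSucc]; exact norm_ne_zero_iff.mpr (hA0 _)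
      refine mul_right_cancel₀ hne ?_
      rw [← hstep, hi]
      linear_combination w (Sum.inl (source e)) * p (source e) (target e) * hms i
  refine ⟨?_, fun k => ?_⟩
  · have := hq (Fin.last n)
    rw [hmn, edgePath_last hn, mul_one] at this
    rw [← this]
    simp [hc, (zero_ne_last hn).symm]
  · have := hq k
    rw [edgePath_interior] at this
    rw [← this]
    simp [hc, k.2.1, k.2.2]

theorem eq_of_connected (hG : G.Connected) {ρ : V → ℝ} (h : ∀ u v, G.Adj u v → ρ u = ρ v)
    (u v : V) : ρ u = ρ v := by
  obtain ⟨q⟩ := hG.preconnected u v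
  induction q with
  | nil => rfl
  | cons hadj _ ih => exact (h _ _ hadj).trans ih

/-- Detailed balance determines the weights up to a constant. -/
theorem exists_eq_const_mul_of_balanced (hG : G.Connected) {p : V → V → ℝ}
    (hp : ∀ u v, G.Adj u v → 0 < p u v) {w w' : V → ℝ} (hw : ∀ x, 0 < w x) (hw' : ∀ x, 0 < w' x)
    (hb : ∀ u v, G.Adj u v → w u * p u v = w v * p v u)
    (hb' : ∀ u v, G.Adj u v → w' u * p u v = w' v * p v u) :
    ∃ c : ℝ, 0 < c ∧ ∀ x, w x = c * w' x := by
  obtain ⟨x₀⟩ := hG.nonempty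
  refine ⟨w x₀ / w' x₀, div_pos (hw _) (hw' _), fun x => ?_⟩
  rw [eq_of_connected hG (ρ := fun x => w x / w' x) _ x₀ x]
  · exact (div_mul_cancel₀ _ (hw' x).ne').symm
  · intro u v huv
    rw [div_eq_div_iff (hw' u).ne' (hw' v).ne']
    refine mul_right_cancel₀ (mul_pos (hp u v huv) (hp v u huv.symm)).ne' ?_
    calc w u * w' v * (p u v * p v u) = (w u * p u v) * (w' v * p v u) := by ring
      _ = (w v * p v u) * (w' u * p u v) := by rw [hb u v huv, hb' u v huv]
      _ = _ := by ring

theorem energy_const_mul {X : Type*} {c : ℝ} (hc : 0 < c) {w w' : X → ℝ}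
    (h : ∀ x, w x = c * w' x) (f : X → ℂ) : energy w f = ENNReal.ofReal c * energy w' f := by
  simp_rw [energy, h, ENNReal.ofReal_mul hc.le, mul_assoc, ENNReal.tsum_mul_left]

theorem isBoundedBelow_congr_weight {X : Type*} {c : ℝ} (hc : 0 < c) {w w' : X → ℝ}
    (h : ∀ x, w x = c * w' x) (L : (X → ℂ) → X → ℂ) (z : ℂ) :
    IsBoundedBelow w L z ↔ IsBoundedBelow w' L z := by
  have hc0 : ENNReal.ofReal c ≠ 0 := by simpa using hc
  have hct : ENNReal.ofReal c ≠ ∞ := ENNReal.ofReal_ne_top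
  refine exists_congr fun C => forall_congr' fun f => ?_
  rw [energy_const_mul hc h, energy_const_mul hc h, mul_left_comm,
    ENNReal.mul_le_mul_iff_right hc0 hct, ENNReal.mul_lt_top_iff]
  have : energy w' f = 0 → energy w' f < ∞ := fun h => by simp [h]
  simp [hc0, hct.lt_top]
  tauto

end Weights

/-! ### Transfer of lower bounds -/

section Transfer

variable {V : Type*} {G : SimpleGraph V} {n : ℕ} {A : Matrix (Fin (n + 1)) (Fin (n + 1)) ℂ}

/-- The conductance of an edge: the weight of an endpoint times the transition probability to the
other endpoint. -/
def conductance (w : SubstVertex G n → ℝ) (p : V → V → ℝ) (e : G.edgeSet) : ℝ≥0∞ :=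
  ENNReal.ofReal (w (Sum.inl (source e)) * p (source e) (target e))

theorem energy_subst (w : SubstVertex G n → ℝ) (g : SubstVertex G n → ℂ) :
    energy w g = energy (w ∘ Sum.inl) (g ∘ Sum.inl) + ∑' e : G.edgeSet, ∑ k : Interior n,
      ENNReal.ofReal (w (Sum.inr (e, k))) * ‖g (Sum.inr (e, k))‖ₑ ^ 2 := by
  rw [energy, ENNReal.summable.tsum_sum ENNReal.summable, ENNReal.tsum_prod']
  simp_rw [tsum_fintype]
  rfl

/-- Weights on the vertices of the substitution graph which satisfy detailed balance on the
vertices of `G` and are comparable to the conductance in the interior of each edge. -/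
structure IsCompatibleWeight (p : V → V → ℝ) (w : SubstVertex G n → ℝ) (M : ℝ≥0) : Prop where
  pos : ∀ x, 0 < w x
  balanced : ∀ e : G.edgeSet, w (Sum.inl (source e)) * p (source e) (target e) =
    w (Sum.inl (target e)) * p (target e) (source e)
  weight_le : ∀ (e : G.edgeSet) (k : Interior n),
    ENNReal.ofReal (w (Sum.inr (e, k))) ≤ M * conductance w p e
  le_weight : ∀ (e : G.edgeSet) (k : Interior n),
    conductance w p e ≤ M * ENNReal.ofReal (w (Sum.inr (e, k)))

variable [G.LocallyFinite] {p : V → V → ℝ} {w : SubstVertex G n → ℝ}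

theorem sum_ofReal_transition (hp : IsTransitionProbability G p) (u : V) :
    ∑ v ∈ G.neighborFinset u, ENNReal.ofReal (p u v) = 1 := by
  rw [← ENNReal.ofReal_sum_of_nonneg fun v _ => hp.nonneg u v, hp.sum_eq_one, ENNReal.ofReal_one]

theorem tsum_weight_mul_transition {M : ℝ≥0} (hw : IsCompatibleWeight p w M) (F : V → V → ℝ≥0∞) :
    ∑' u, ENNReal.ofReal (w (Sum.inl u)) *
        ∑ v ∈ G.neighborFinset u, ENNReal.ofReal (p u v) * F u v =
      ∑' e : G.edgeSet, conductance w p e *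
        (F (source e) (target e) + F (target e) (source e)) := by
  simp_rw [Finset.mul_sum]
  rw [tsum_sum_neighborFinset
    (F := fun u v => ENNReal.ofReal (w (Sum.inl u)) * (ENNReal.ofReal (p u v) * F u v))]
  refine tsum_congr fun e => ?_
  rw [← mul_assoc, ← mul_assoc, ← ENNReal.ofReal_mul (hw.pos _).le,
    ← ENNReal.ofReal_mul (hw.pos _).le, ← hw.balanced, mul_add]
  rfl

theorem tsum_conductance_mul (hp : IsTransitionProbability G p) {M : ℝ≥0}
    (hw : IsCompatibleWeight p w M) (f : V → ℂ) :
    ∑' e : G.edgeSet, conductance w p e * (‖f (source e)‖ₑ ^ 2 + ‖f (target e)‖ₑ ^ 2) =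
      energy (w ∘ Sum.inl) f := by
  rw [← tsum_weight_mul_transition hw fun u _ => ‖f u‖ₑ ^ 2]
  simp_rw [← Finset.sum_mul, sum_ofReal_transition hp, one_mul]
  rfl

/-- Solving the equation in the interior of the edges is bounded. -/
theorem energy_le_of_path_bound (hp : IsTransitionProbability G p) {M C : ℝ≥0}
    (hw : IsCompatibleWeight p w M) (hn : 1 ≤ n) {z : ℂ}
    (hC : ∀ (v : Fin (n + 1) → ℂ) k, ‖v k‖ₑ ^ 2 ≤
      C * (‖v 0‖ₑ ^ 2 + ‖v (Fin.last n)‖ₑ ^ 2 + interiorEnergy A z v))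
    (g : SubstVertex G n → ℂ) :
    energy w g ≤ energy (w ∘ Sum.inl) (g ∘ Sum.inl) + (Fintype.card (Interior n) * M * C : ℝ≥0) *
      (energy (w ∘ Sum.inl) (g ∘ Sum.inl) +
        ∑' e : G.edgeSet, conductance w p e * interiorEnergy A z (g ∘ edgePath e)) := by
  rw [energy_subst]
  refine add_le_add le_rfl ?_
  rw [← tsum_conductance_mul hp hw (g ∘ Sum.inl), ← ENNReal.tsum_add, ← ENNReal.tsum_mul_left]
  refine ENNReal.tsum_le_tsum fun e => ?_
  have h (k : Interior n) : ENNReal.ofReal (w (Sum.inr (e, k))) * ‖g (Sum.inr (e, k))‖ₑ ^ 2 ≤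
      (M * conductance w p e) * (C * (‖g (Sum.inl (source e))‖ₑ ^ 2 +
        ‖g (Sum.inl (target e))‖ₑ ^ 2 + interiorEnergy A z (g ∘ edgePath e))) := by
    have := hC (g ∘ edgePath e) k
    simp only [Function.comp_apply, edgePath_zero, edgePath_last hn, edgePath_interior] at this
    exact mul_le_mul' (hw.weight_le e k) this
  refine (Finset.sum_le_sum fun k _ => h k).trans_eq ?_
  rw [Finset.sum_const, Finset.card_univ, nsmul_eq_mul]
  simp only [Function.comp_apply]
  push_cast
  ring

/-- Let `R z ≠ 0, 2`. Eliminating the interior of the edges shows that `z - J` is bounded below if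
and only if `R z - Δ` is bounded below. -/
theorem isBoundedBelow_subst_iff (hp : IsTransitionProbability G p) {M : ℝ≥0}
    (hw : IsCompatibleWeight p w M) (hn : 1 ≤ n) (hA : IsCentrosymmetricJacobi A)
    (hA0 : ∀ i : Fin n, A i.castSucc i.succ ≠ 0) {z : ℂ}
    (hz0 : decimationFunction A z ≠ 0) (hz2 : decimationFunction A z ≠ 2) :
    IsBoundedBelow w (matrixAction (substJacobi G p A)) z ↔
      IsBoundedBelow (w ∘ Sum.inl) (probLaplacian G p) (decimationFunction A z) := by
  obtain ⟨φ, b, C, hb, hφ0, hφn, hφ, hr0, hrn, hC, hdef⟩ := hA.exists_elimination hn hA0 hz0 hz2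
  set R := decimationFunction A z with hR
  set K : ℝ≥0 := Fintype.card (Interior n) * M * C with hK
  have hp1 (u : V) : ∑ v ∈ G.neighborFinset u, (p u v : ℂ) = 1 := by
    rw [← Complex.ofReal_sum, hp.sum_eq_one, Complex.ofReal_one]
  -- The Schur complement of the interior of the edges is a multiple of `R - Δ`.
  have hschur (f : V → ℂ) (u : V) : ∑ v ∈ G.neighborFinset u,
      (p u v : ℂ) * ((R - 1) * b * f u + b * f v) = b * (R * f u - probLaplacian G p f u) := by
    have h1 (v : V) : (p u v : ℂ) * ((R - 1) * b * f u + b * f v) =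
        p u v * ((R - 1) * b * f u) + b * (p u v * f v) := by ring
    simp_rw [h1, Finset.sum_add_distrib, ← Finset.sum_mul, ← Finset.mul_sum, hp1, probLaplacian]
    ring
  constructor
  · rintro ⟨C₀, hC₀⟩
    refine ⟨C₀ * ‖b‖₊ ^ 2, fun f hf => ?_⟩
    -- The extension of `f` which solves the equation in the interior of the edges.
    let g : SubstVertex G n → ℂ := Sum.elim f fun x =>
      f (source x.1) * φ x.2 + f (target x.1) * φ (x.2 : Fin (n + 1)).rev
    have hpath (e : G.edgeSet) : g ∘ edgePath e =
        fun k => f (source e) * φ k + f (target e) * (φ ∘ Fin.rev) k := by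
      ext k
      rcases path_cases k with rfl | rfl | ⟨k, rfl⟩
      · simp [g, hφ0, hφn]
      · simp [g, hφ0, hφn, edgePath_last hn]
      · simp [g]
    have hrev {k : Fin (n + 1)} (hk : k ≠ 0) (hk' : k ≠ Fin.last n) :
        pencil A z (φ ∘ Fin.rev) k = 0 := by
      rw [hA.pencil_comp_rev]
      refine hφ _ (fun h => hk' ?_) fun h => hk ?_
      · rw [← Fin.rev_rev k, h, Fin.rev_zero]
      · rw [← Fin.rev_rev k, h, Fin.rev_last]
    have hint (e : G.edgeSet) (k : Interior n) : pencil A z (g ∘ edgePath e) k = 0 := by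
      rw [hpath, pencil_linearCombination, hφ _ k.2.1 k.2.2, hrev k.2.1 k.2.2]
      simp
    have hpull {u v : V} (h : G.Adj u v) :
        pathPull g u v = fun k => f u * φ k + f v * (φ ∘ Fin.rev) k := by
      obtain ⟨e, ⟨rfl, rfl⟩ | ⟨rfl, rfl⟩⟩ := exists_edge_of_adj h
      · rw [pathPull_source_target, hpath]
      · rw [pathPull_target_source, hpath]
        ext k
        simp [add_comm]
    have hJg : energy w (fun x => z * g x - matrixAction (substJacobi G p A) g x) =
        (‖b‖₊ ^ 2 : ℝ≥0) * energy (w ∘ Sum.inl) fun u => R * f u - probLaplacian G p f u := by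
      rw [energy_subst, energy, energy, ← ENNReal.tsum_mul_left]
      simp only [sub_matrixAction_interior hn, hint, enorm_zero, ne_eq, OfNat.ofNat_ne_zero,
        not_false_eq_true, zero_pow, mul_zero, Finset.sum_const_zero, tsum_zero, add_zero,
        Function.comp_apply]
      refine tsum_congr fun u => ?_
      rw [sub_matrixAction_vertex hn hA hp, mul_left_comm]
      have h1 : ∑ v ∈ G.neighborFinset u, (p u v : ℂ) * pencil A z (pathPull g u v) 0 =
          b * (R * f u - probLaplacian G p f u) := by
        rw [← hschur]
        refine Finset.sum_congr rfl fun v hv => ?_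
        rw [hpull (by simpa using hv), pencil_linearCombination, hr0, hA.pencil_comp_rev,
          Fin.rev_zero, hrn]
        ring
      rw [h1, enorm_mul, mul_pow, ENNReal.coe_pow, enorm_eq_nnnorm b]
    have hgf : g ∘ Sum.inl = f := rfl
    have hfin : energy w g < ∞ := by
      refine (energy_le_of_path_bound hp hw hn hC g).trans_lt ?_
      simp only [hgf, interiorEnergy, hint, enorm_zero, ne_eq, OfNat.ofNat_ne_zero,
        not_false_eq_true, zero_pow, mul_zero, Finset.sum_const_zero, tsum_zero, add_zero]
      exact ENNReal.add_lt_top.mpr ⟨hf, ENNReal.mul_lt_top ENNReal.coe_lt_top hf⟩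
    calc energy (w ∘ Sum.inl) f ≤ energy w g := by rw [energy_subst, hgf]; exact le_self_add
      _ ≤ C₀ * _ := hC₀ g hfin
      _ = _ := by rw [hJg, ENNReal.coe_mul, mul_assoc]
  · rintro ⟨C₁, hC₁⟩
    refine ⟨(1 + K) * (C₁ * ((‖b‖₊ ^ 2)⁻¹ * (2 * (1 + C * (2 * M))))) + K * M, fun g hg => ?_⟩
    set h : SubstVertex G n → ℂ := fun x => z * g x - matrixAction (substJacobi G p A) g x with hh
    set f : V → ℂ := g ∘ Sum.inl with hf
    have hffin : energy (w ∘ Sum.inl) f < ∞ := by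
      refine lt_of_le_of_lt ?_ hg
      rw [energy_subst w g]
      exact le_self_add
    have hle : energy (w ∘ Sum.inl) (h ∘ Sum.inl) ≤ energy w h := by
      rw [energy_subst w h]; exact le_self_add
    have hint : ∑' e : G.edgeSet, conductance w p e * interiorEnergy A z (g ∘ edgePath e) ≤
        M * energy w h := by
      rw [energy_subst w h]
      refine le_trans ?_ (mul_le_mul_right le_add_self _)
      rw [← ENNReal.tsum_mul_left]
      refine ENNReal.tsum_le_tsum fun e => ?_
      rw [interiorEnergy, Finset.mul_sum, Finset.mul_sum]
      refine Finset.sum_le_sum fun k _ => ?_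
      have hk : h (Sum.inr (e, k)) = pencil A z (g ∘ edgePath e) k :=
        sub_matrixAction_interior hn p z g e k
      rw [hk, ← mul_assoc]
      gcongr
      exact hw.le_weight e k
    -- The equation for `f` holds up to the mean of the errors in the boundary rows.
    have hvert (u : V) : (‖b‖₊ ^ 2 : ℝ≥0) * ‖R * f u - probLaplacian G p f u‖ₑ ^ 2 ≤
        2 * (‖h (Sum.inl u)‖ₑ ^ 2 + C * ∑ v ∈ G.neighborFinset u,
          ENNReal.ofReal (p u v) * interiorEnergy A z (pathPull g u v)) := by
      set d : V → ℂ := fun v =>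
        -(pencil A z (pathPull g u v) 0 - ((R - 1) * b * f u + b * f v)) with hd
      have h1 : b * (R * f u - probLaplacian G p f u) =
          h (Sum.inl u) + ∑ v ∈ G.neighborFinset u, (p u v : ℂ) * d v := by
        have hu : h (Sum.inl u) = _ := sub_matrixAction_vertex hn hA hp z g u
        rw [← hschur, hu, ← Finset.sum_add_distrib]
        refine Finset.sum_congr rfl fun v _ => ?_
        rw [hd]; ring
      have h2 : ‖∑ v ∈ G.neighborFinset u, (p u v : ℂ) * d v‖ₑ ^ 2 ≤
          C * ∑ v ∈ G.neighborFinset u,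
            ENNReal.ofReal (p u v) * interiorEnergy A z (pathPull g u v) := by
        refine (enorm_weighted_sum_sq_le _ _ (fun v _ => hp.nonneg u v)
          (hp.sum_eq_one u) _).trans ?_
        rw [Finset.mul_sum]
        refine Finset.sum_le_sum fun v hv => ?_
        have hadj : G.Adj u v := by simpa using hv
        have h3 := hdef (pathPull g u v)
        rw [pathPull_zero hn g hadj, pathPull_last hn g hadj] at h3
        rw [hd, enorm_neg, mul_left_comm]
        exact mul_le_mul_right h3 _
      calc (‖b‖₊ ^ 2 : ℝ≥0) * ‖R * f u - probLaplacian G p f u‖ₑ ^ 2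
          = ‖b * (R * f u - probLaplacian G p f u)‖ₑ ^ 2 := by
            rw [enorm_mul, mul_pow, ENNReal.coe_pow, enorm_eq_nnnorm b]
        _ ≤ _ := by
            rw [h1]
            refine (enorm_add_sq_le _ _).trans ?_
            gcongr
    have hsum : (‖b‖₊ ^ 2 : ℝ≥0) *
        energy (w ∘ Sum.inl) (fun u => R * f u - probLaplacian G p f u) ≤
          (2 * (1 + C * (2 * M)) : ℝ≥0) * energy w h := by
      have hpath : ∑' u, ENNReal.ofReal (w (Sum.inl u)) * ∑ v ∈ G.neighborFinset u,
          ENNReal.ofReal (p u v) * interiorEnergy A z (pathPull g u v) ≤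
            2 * (M * energy w h) := by
        rw [tsum_weight_mul_transition hw fun u v => interiorEnergy A z (pathPull g u v)]
        simp only [pathPull_source_target, pathPull_target_source, hA.interiorEnergy_comp_rev]
        simp_rw [← two_mul, mul_left_comm _ (2 : ℝ≥0∞), ENNReal.tsum_mul_left]
        gcongr
      calc (‖b‖₊ ^ 2 : ℝ≥0) *
            energy (w ∘ Sum.inl) (fun u => R * f u - probLaplacian G p f u)
          = ∑' u, ENNReal.ofReal (w (Sum.inl u)) *
              ((‖b‖₊ ^ 2 : ℝ≥0) * ‖R * f u - probLaplacian G p f u‖ₑ ^ 2) := by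
            rw [energy, ← ENNReal.tsum_mul_left]
            exact tsum_congr fun u => mul_left_comm _ _ _
        _ ≤ ∑' u, ENNReal.ofReal (w (Sum.inl u)) *
              (2 * (‖h (Sum.inl u)‖ₑ ^ 2 + C * ∑ v ∈ G.neighborFinset u,
                ENNReal.ofReal (p u v) * interiorEnergy A z (pathPull g u v))) := by
            exact ENNReal.tsum_le_tsum fun u => mul_le_mul_right (hvert u) _
        _ = 2 * (energy (w ∘ Sum.inl) (h ∘ Sum.inl) + C * ∑' u, ENNReal.ofReal (w (Sum.inl u)) *
              ∑ v ∈ G.neighborFinset u,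
                ENNReal.ofReal (p u v) * interiorEnergy A z (pathPull g u v)) := by
            rw [energy, ← ENNReal.tsum_mul_left, ← ENNReal.tsum_add, ← ENNReal.tsum_mul_left]
            refine tsum_congr fun u => ?_
            simp only [Function.comp_apply]
            ring
        _ ≤ 2 * (energy w h + C * (2 * (M * energy w h))) := by gcongr
        _ = _ := by push_cast; ring
    have hb2 : ‖b‖₊ ^ 2 ≠ 0 := pow_ne_zero 2 (nnnorm_ne_zero_iff.mpr hb)
    have hf_le : energy (w ∘ Sum.inl) f ≤
        (C₁ * ((‖b‖₊ ^ 2)⁻¹ * (2 * (1 + C * (2 * M)))) : ℝ≥0) * energy w h := by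
      refine (hC₁ f hffin).trans ?_
      rw [ENNReal.coe_mul, mul_assoc]
      gcongr
      calc energy (w ∘ Sum.inl) (fun u => R * f u - probLaplacian G p f u)
          = ((‖b‖₊ ^ 2)⁻¹ : ℝ≥0) * ((‖b‖₊ ^ 2 : ℝ≥0) *
              energy (w ∘ Sum.inl) (fun u => R * f u - probLaplacian G p f u)) := by
            rw [← mul_assoc, ← ENNReal.coe_mul, inv_mul_cancel₀ hb2, ENNReal.coe_one, one_mul]
        _ ≤ _ := by
            rw [ENNReal.coe_mul, mul_assoc]
            gcongr
    calc energy w g ≤ _ := energy_le_of_path_bound hp hw hn hC g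
      _ ≤ energy (w ∘ Sum.inl) f + K * (energy (w ∘ Sum.inl) f + M * energy w h) := by gcongr
      _ = (1 + K) * energy (w ∘ Sum.inl) f + (K * M) * energy w h := by ring
      _ ≤ (1 + K) * ((C₁ * ((‖b‖₊ ^ 2)⁻¹ * (2 * (1 + C * (2 * M)))) : ℝ≥0) * energy w h) +
          (K * M) * energy w h := by gcongr
      _ = _ := by push_cast; ring

end Transfer

/-! ### Openness of the decimation function -/

section OpenMapping

variable {n : ℕ}

theorem leadingPoly_eq_eval_charpoly (A : Matrix (Fin (n + 1)) (Fin (n + 1)) ℂ) (z : ℂ) :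
    leadingPoly A z = (A.submatrix Fin.castSucc Fin.castSucc).charpoly.eval z := by
  rw [Matrix.eval_charpoly, leadingPoly, Matrix.scalar_apply, Matrix.smul_one_eq_diagonal]

/-- The decimation function is a polynomial of degree `n ≥ 1`, hence open. -/
theorem nhds_le_map_decimationFunction (hn : 1 ≤ n) {A : Matrix (Fin (n + 1)) (Fin (n + 1)) ℂ}
    (hA0 : ∀ i : Fin n, A i.castSucc i.succ ≠ 0) (z : ℂ) :
    𝓝 (decimationFunction A z) ≤ map (decimationFunction A) (𝓝 z) := by
  have hup := upperProd_ne_zero hA0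
  set P := (A.submatrix Fin.castSucc Fin.castSucc).charpoly with hP
  have hfun (x : ℂ) : decimationFunction A x = 1 - P.eval x / upperProd A := by
    rw [decimationFunction, leadingPoly_eq_eval_charpoly]
  have han : AnalyticAt ℂ (decimationFunction A) z := by
    rw [funext hfun]
    exact analyticAt_const.sub ((AnalyticOnNhd.eval_polynomial P z trivial).div_const)
  refine han.eventually_constant_or_nhds_le_map_nhds.resolve_left fun h => ?_
  have hconst : P = Polynomial.C (P.eval z) := by
    refine Polynomial.eq_of_infinite_eval_eq _ _ ((infinite_of_mem_nhds z h).mono fun x hx => ?_)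
    have hx' : decimationFunction A x = decimationFunction A z := hx
    rw [hfun, hfun, sub_right_inj, div_left_inj' hup] at hx'
    simpa using hx'
  have hdeg : P.natDegree = n := by rw [hP, Matrix.charpoly_natDegree_eq_dim, Fintype.card_fin]
  rw [hconst, Polynomial.natDegree_C] at hdeg
  omega

end OpenMapping

/-! ### The spectrum -/

theorem exists_isCompatibleWeight {V : Type*} {G : SimpleGraph V} {n : ℕ} {p : V → V → ℝ}
    {w : SubstVertex G n → ℝ} (hw : ∀ x, 0 < w x) {m : Interior n → ℝ} (hm : ∀ k, 0 < m k)
    (h : ∀ e : G.edgeSet, w (Sum.inl (source e)) * p (source e) (target e) =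
        w (Sum.inl (target e)) * p (target e) (source e) ∧
      ∀ k, w (Sum.inr (e, k)) = w (Sum.inl (source e)) * p (source e) (target e) * m k) :
    ∃ M : ℝ≥0, IsCompatibleWeight p w M := by
  set M : ℝ≥0 := ∑ k, ((m k).toNNReal + (m k)⁻¹.toNNReal) with hM
  have hle (k : Interior n) : (m k).toNNReal + (m k)⁻¹.toNNReal ≤ M :=
    Finset.single_le_sum (f := fun k => (m k).toNNReal + (m k)⁻¹.toNNReal)
      (fun _ _ => zero_le) (Finset.mem_univ k)
  have h1 (k : Interior n) : ENNReal.ofReal (m k) ≤ M :=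
    ENNReal.coe_le_coe.mpr (le_self_add.trans (hle k))
  have h2 (k : Interior n) : ENNReal.ofReal (m k)⁻¹ ≤ M :=
    ENNReal.coe_le_coe.mpr (le_add_self.trans (hle k))
  refine ⟨M, hw, fun e => (h e).1, fun e k => ?_, fun e k => ?_⟩
  · rw [(h e).2 k, mul_comm, ENNReal.ofReal_mul (hm k).le]
    exact mul_le_mul_left (h1 k) _
  · have : w (Sum.inl (source e)) * p (source e) (target e) = (m k)⁻¹ * w (Sum.inr (e, k)) := by
      rw [(h e).2 k]; field_simp [(hm k).ne']
    rw [conductance, this, ENNReal.ofReal_mul (inv_pos.mpr (hm k)).le]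
    exact mul_le_mul_left (h2 k) _

end PiecewiseCentrosymmetric

open PiecewiseCentrosymmetric

theorem corollary4p8 {V : Type*} (G : SimpleGraph V) [G.LocallyFinite] (hG : G.Connected)
    (p : V → V → ℝ) (hp : PiecewiseCentrosymmetric.IsTransitionProbability G p)
    {n : ℕ} (hn : 1 ≤ n) (A : Matrix (Fin (n + 1)) (Fin (n + 1)) ℂ)
    (hA : PiecewiseCentrosymmetric.IsCentrosymmetricJacobi A)
    (hA0 : ∀ i : Fin n, A i.castSucc i.succ ≠ 0)
    (wp : V → ℝ) (hwp : ∀ x, 0 < wp x)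
    (wJ : PiecewiseCentrosymmetric.SubstVertex G n → ℝ) (hwJ : ∀ x, 0 < wJ x)
    (D : PiecewiseCentrosymmetric.WeightedEll2 wp →L[ℂ] PiecewiseCentrosymmetric.WeightedEll2 wp)
    (hD : PiecewiseCentrosymmetric.ActsAs D (PiecewiseCentrosymmetric.probLaplacian G p))
    (hDsa : IsSelfAdjoint D)
    (J : PiecewiseCentrosymmetric.WeightedEll2 wJ →L[ℂ] PiecewiseCentrosymmetric.WeightedEll2 wJ)
    (hJ : PiecewiseCentrosymmetric.ActsAs J (PiecewiseCentrosymmetric.matrixAction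
      (PiecewiseCentrosymmetric.substJacobi G p A)))
    (hJsa : IsSelfAdjoint J)
    (h0 : AccPt (0 : ℂ) (Filter.principal (spectrum ℂ D)))
    (h2 : AccPt (2 : ℂ) (Filter.principal (spectrum ℂ D))) :
    spectrum ℂ J = PiecewiseCentrosymmetric.decimationFunction A ⁻¹' spectrum ℂ D := by
  obtain ⟨m, hm, hmw⟩ :=
    exists_weight_interior hp hn hA hA0 hwJ hJ hJsa
  obtain ⟨M, hM⟩ := exists_isCompatibleWeight hwJ hm hmw
  obtain ⟨c, hc, hcw⟩ := exists_eq_const_mul_of_balanced hG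
    (fun u v huv => hp.pos huv) hwp (fun x => hwJ (Sum.inl x))
    (fun u v huv => weight_mul_transition_comm hwp hD hDsa huv)
    (fun u v huv => by
      obtain ⟨e, ⟨rfl, rfl⟩ | ⟨rfl, rfl⟩⟩ := exists_edge_of_adj huv
      exacts [hM.balanced e, (hM.balanced e).symm])
  have hregular (z : ℂ) (hz0 : decimationFunction A z ≠ 0)
      (hz2 : decimationFunction A z ≠ 2) :
      z ∈ spectrum ℂ J ↔ decimationFunction A z ∈ spectrum ℂ D := by
    rw [← not_iff_not, notMem_spectrum_iff_isBoundedBelow hwJ hJ hJsa,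
      notMem_spectrum_iff_isBoundedBelow hwp hD hDsa,
      isBoundedBelow_subst_iff hp hM hn hA hA0 hz0 hz2,
      isBoundedBelow_congr_weight hc hcw]
    rfl
  have hexceptional (z : ℂ)
      (hacc : AccPt (decimationFunction A z)
        (Filter.principal (spectrum ℂ D)))
      (hz : decimationFunction A z = 0 ∨
        decimationFunction A z = 2) :
      z ∈ spectrum ℂ J ∧ decimationFunction A z ∈ spectrum ℂ D := by
    refine ⟨?_, (spectrum.isClosed D).closure_subset (mem_closure_iff_clusterPt.mpr hacc.clusterPt)⟩
    rw [← (spectrum.isClosed J).closure_eq, mem_closure_iff_nhds]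
    intro U hU
    have himage : decimationFunction A '' U ∈
        𝓝 (decimationFunction A z) :=
      nhds_le_map_decimationFunction hn hA0 z (Filter.image_mem_map hU)
    obtain ⟨y, ⟨⟨⟨x, hxU, rfl⟩, hball⟩, hyD⟩, hyne⟩ := accPt_iff_nhds.mp hacc _
      (Filter.inter_mem himage (Metric.ball_mem_nhds _ one_pos))
    -- The point `R x` is within distance `1` of `R z`, so it is not the other one of `0` and `2`.
    have hsep (a b : ℂ) (hab : dist a b = 2)
        (hzb : decimationFunction A z = b) :
        decimationFunction A x ≠ a := by
      rintro rfl
      rw [Metric.mem_ball, hzb, hab] at hball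
      norm_num at hball
    have hd : dist (0 : ℂ) 2 = 2 := by simp
    refine ⟨x, hxU, (hregular x ?_ ?_).mpr hyD⟩
    · rcases hz with hz | hz
      · rwa [hz] at hyne
      · exact hsep 0 2 hd hz
    · rcases hz with hz | hz
      · exact hsep 2 0 (by rw [dist_comm, hd]) hz
      · rwa [hz] at hyne
  ext z
  rw [Set.mem_preimage]
  by_cases hz0 : decimationFunction A z = 0
  · have h := hexceptional z (hz0 ▸ h0) (Or.inl hz0)
    exact ⟨fun _ => h.2, fun _ => h.1⟩
  by_cases hz2 : decimationFunction A z = 2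
  · have h := hexceptional z (hz2 ▸ h2) (Or.inr hz2)
    exact ⟨fun _ => h.2, fun _ => h.1⟩
  exact hregular z hz0 hz2

end
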